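/- **Proposition (Optimal Approximations of the Posterior Mean).** Let $n,p,k\ge 0$ be integers, $\mathbf H\in\mathbb R^{p\times n}$, and let $\mathbf B\in\mathbb R^{n\times n}$ and $\mathbf R\in\mathbb R^{p\times p}$ be symmetric positive definite. Let $\mathbf x\sim\mathcal N(0,\mathbf B)$ and $\boldsymbol\epsilon\sim\mathcal N(0,\mathbf R)$ be independent random vectors (true increment and observation error), let $\mathbf d=\mathbf H\mathbf x+\boldsymbol\epsilon$ be the innovation, and put $$\mathbf Y=\mathbf H\mathbf B\mathbf H^T+\mathbf R,\qquad \mathbf K=\mathbf B\mathbf H^T\mathbf Y^{-1},\qquad \mathbf P^a=(\mathbf B^{-1}+\mathbf H^T\mathbf R^{-1}\mathbf H)^{-1}.$$ The posterior mean is $\mathbf x^a=\mathbf K\mathbf d$ (so that $\mathbf x^a=\mathbb E[\mathbf x\mid\mathbf d]$ almost surely). $\mathbf S^{1/2}$ denotes the positive semidefinite square root of a positive semidefinite matrix $\mathbf S$. Let $(\mathbf v_i,\lambda_i)_{i=1}^n$ and $(\mathbf u_i,\delta_i)_{i=1}^n$ be orthonormal eigenpairs, with eigenvalues in descending order, of $\mathbf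 B^{1/2}\mathbf H^T\mathbf R^{-1}\mathbf H\mathbf B^{1/2}$ and of $\mathbf Q_{\mathrm{var}}=\mathbf B-\mathbf P^a$, respectively. Sums over $i\le k$ and $i>k$ are restricted to $1\le i\le n$. Define three approximations of $\mathbf x^a$: * $\mathbf x^a_{\mathrm{var}}=\mathbf K_{\mathrm{var}}\mathbf d$ with $\mathbf K_{\mathrm{var}}=\big(\sum_{i\le k}\delta_i^{1/2}\,\mathbf u_i\mathbf z_i^T\big)\mathbf Y^{-1/2}$, where $\mathbf z_i=\delta_i^{-1/2}\,\mathbf Y^{-1/2}\mathbf H\mathbf B\,\mathbf u_i$ (and $\mathbf z_i=0$ if $\delta_i=0$). * $\mathbf x^a_{\Pi_{\mathrm{dof}}}=\mathbf K_{\mathrm{dof}}\mathbf d$ is the posterior mean of the Bayesian problem projected by $\mathbf\Pi=\mathbf B^{1/2}\big(\sum_{i\le k}\mathbf v_i\mathbf v_i^T\big)\mathbf B^{-1/2}$, that is, $\mathbf K_{\mathrm{dof}}=\mathbf\Pi\mathbf B\mathbf\Pi^T\mathbf H^T\big(\mathbf H\mathbf\Pi\mathbf B\mathbf\Pi^T\mathbf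 H^T+\mathbf R_\Pi\big)^{-1}$ with $\mathbf R_\Pi=\mathbf R+\mathbf H(\mathbf B+\mathbf\Pi\mathbf B\mathbf\Pi^T-\mathbf B\mathbf\Pi^T-\mathbf\Pi\mathbf B)\mathbf H^T$. * $\mathbf x^a_{\mathrm{FR}_{\mathrm{dof}}}=\mathbf P_{\mathrm{dof}}\mathbf H^T\mathbf R^{-1}\mathbf d$ with $\mathbf P_{\mathrm{dof}}=\mathbf B-\mathbf B^{1/2}\big(\sum_{i\le k}\tfrac{\lambda_i}{1+\lambda_i}\mathbf v_i\mathbf v_i^T\big)\mathbf B^{1/2}$. Let $\mathcal A_k$ be the set of $n\times p$ matrices of rank at most $k$, let $\hat{\mathcal A}_k$ be the set of positive semidefinite matrices of the form $\mathbf B-\mathbf Q\mathbf Q^T$ with $\mathbf Q\in\mathbb R^{n\times n}$ and $\operatorname{rank}\mathbf Q\le k$, and write $\|\mathbf x\|_{\mathbf W}^2=\mathbf x^T\mathbf W\mathbf x$, with $\|\cdot\|$ the Euclidean norm. Then $\mathbf K_{\mathrm{var}},\mathbf K_{\mathrm{dof}}\in\mathcal A_k$ and $\mathbf P_{\mathrm{dof}}\in\hat{\mathcal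 A}_k$, all the expectations below are finite, all the minima are attained, and $$\begin{aligned} \mathbb E\|\mathbf x^a_{\mathrm{var}}-\mathbf x^a\|^2&=\min_{\tilde{\mathbf K}\in\mathcal A_k}\mathbb E\|(\tilde{\mathbf K}-\mathbf K)\mathbf d\|^2=\sum_{i>k}\delta_i,\\ \mathbb E\|\mathbf x^a_{\Pi_{\mathrm{dof}}}-\mathbf x^a\|_{\mathbf B^{-1}}^2&=\min_{\tilde{\mathbf K}\in\mathcal A_k}\mathbb E\|(\tilde{\mathbf K}-\mathbf K)\mathbf d\|_{\mathbf B^{-1}}^2=\sum_{i>k}\frac{\lambda_i}{1+\lambda_i},\\ \mathbb E\|\mathbf x^a_{\Pi_{\mathrm{dof}}}-\mathbf x^a\|_{(\mathbf P^a)^{-1}}^2&=\min_{\tilde{\mathbf K}\in\mathcal A_k}\mathbb E\|(\tilde{\mathbf K}-\mathbf K)\mathbf d\|_{(\mathbf P^a)^{-1}}^2=\sum_{i>k}\lambda_i,\\ \mathbb E\|\mathbf x^a_{\mathrm{FR}_{\mathrm{dof}}}-\mathbf x^a\|_{\mathbf B^{-1}}^2&=\min_{\tilde{\mathbf P}\in\hat{\mathcal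 A}_k}\mathbb E\|(\tilde{\mathbf P}-\mathbf P^a)\mathbf H^T\mathbf R^{-1}\mathbf d\|_{\mathbf B^{-1}}^2=\sum_{i>k}\frac{\lambda_i^3}{1+\lambda_i},\\ \mathbb E\|\mathbf x^a_{\mathrm{FR}_{\mathrm{dof}}}-\mathbf x^a\|_{(\mathbf P^a)^{-1}}^2&=\min_{\tilde{\mathbf P}\in\hat{\mathcal A}_k}\mathbb E\|(\tilde{\mathbf P}-\mathbf P^a)\mathbf H^T\mathbf R^{-1}\mathbf d\|_{(\mathbf P^a)^{-1}}^2=\sum_{i>k}\lambda_i^3 . \end{aligned}$$ -/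

import Mathlib

open MeasureTheory ProbabilityTheory Matrix

noncomputable section

/-- The positive semidefinite square root `S^{1/2}` of a positive semidefinite matrix `S`. -/
def matSqrt {m : ℕ} (S : Matrix (Fin m) (Fin m) ℝ) : Matrix (Fin m) (Fin m) ℝ :=
  open scoped MatrixOrder in CFC.sqrt S

/-- The matrix-vector product `M x` on column vectors with the Euclidean norm. -/
def act {m l : ℕ} (M : Matrix (Fin m) (Fin l) ℝ) (x : EuclideanSpace ℝ (Fin l)) :
    EuclideanSpace ℝ (Fin m) :=
  WithLp.toLp 2 (M *ᵥ x.ofLp)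

/-- The weighted Euclidean norm `‖x‖_W = √(xᵀ W x)`. -/
def weightedNorm {m : ℕ} (W : Matrix (Fin m) (Fin m) ℝ) (x : EuclideanSpace ℝ (Fin m)) : ℝ :=
  Real.sqrt (x.ofLp ⬝ᵥ (W *ᵥ x.ofLp))

/-- `Q = V diag(ev) Vᵀ` is an orthonormal eigendecomposition of `Q`, the eigenvalues being listed
in descending order; the `i`-th eigenvector is the `i`-th column of `V`. -/
structure IsEigendecomposition {m : ℕ} (Q V : Matrix (Fin m) (Fin m) ℝ) (ev : Fin m → ℝ) :
    Prop where
  orthonormal : Vᵀ * V = 1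
  eigen : Q * V = V * Matrix.diagonal ev
  descending : Antitone ev

/-- The class of matrices of rank at most `k`. -/
def lowRank (m l k : ℕ) : Set (Matrix (Fin m) (Fin l) ℝ) :=
  {M | M.rank ≤ k}

/-- The class of rank-`k` negative updates `B - Q Qᵀ ≥ 0` of the matrix `B`. -/
def lowRankUpdate {n : ℕ} (B : Matrix (Fin n) (Fin n) ℝ) (k : ℕ) :
    Set (Matrix (Fin n) (Fin n) ℝ) :=
  {M | ∃ Q : Matrix (Fin n) (Fin n) ℝ, Q.rank ≤ k ∧ M = B - Q * Qᵀ ∧ M.PosSemidef}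

/-- The data of a linear Gaussian Bayesian problem with control space `ℝⁿ` and observation space
`ℝᵖ`, in incremental form: forward model `H`, prior error covariance `B`, observational error
covariance `R`. -/
structure BayesianProblem (n p : ℕ) where
  H : Matrix (Fin p) (Fin n) ℝ
  B : Matrix (Fin n) (Fin n) ℝ
  R : Matrix (Fin p) (Fin p) ℝ

namespace BayesianProblem

variable {n p : ℕ} (𝓑 : BayesianProblem n p)

/-- The matrix of innovation statistics `H B Hᵀ + R`. -/
def innovationCov : Matrix (Fin p) (Fin p) ℝ :=
  𝓑.H * 𝓑.B * 𝓑.Hᵀ + 𝓑.R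

/-- The gain matrix `K = B Hᵀ (H B Hᵀ + R)⁻¹`. -/
def gain : Matrix (Fin n) (Fin p) ℝ :=
  𝓑.B * 𝓑.Hᵀ * 𝓑.innovationCov⁻¹

/-- The posterior mean (increment) `xᵃ = K d` for the innovation `d`. -/
def posteriorMean (d : EuclideanSpace ℝ (Fin p)) : EuclideanSpace ℝ (Fin n) :=
  act 𝓑.gain d

/-- The posterior error covariance `Pᵃ = (B⁻¹ + Hᵀ R⁻¹ H)⁻¹`. -/
def posteriorCov : Matrix (Fin n) (Fin n) ℝ :=
  (𝓑.B⁻¹ + 𝓑.Hᵀ * 𝓑.R⁻¹ * 𝓑.H)⁻¹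

/-- The Bayesian problem projected by `Pi`, in the canonical basis: forward model `H Pi`, prior
covariance `Pi B Piᵀ`, and observational error covariance including the representativeness error. -/
def projected (Pi : Matrix (Fin n) (Fin n) ℝ) : BayesianProblem n p where
  H := 𝓑.H * Pi
  B := Pi * 𝓑.B * Piᵀ
  R := 𝓑.R + 𝓑.H * (𝓑.B + Pi * 𝓑.B * Piᵀ - 𝓑.B * Piᵀ - Pi * 𝓑.B) * 𝓑.Hᵀ

/-- The prior-preconditioned Hessian `B^{1/2} Hᵀ R⁻¹ H B^{1/2}`. -/
def priorPreconditionedHessian : Matrix (Fin n) (Fin n) ℝ :=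
  matSqrt 𝓑.B * 𝓑.Hᵀ * 𝓑.R⁻¹ * 𝓑.H * matSqrt 𝓑.B

/-- The information matrix `Q_var = B - Pᵃ`. -/
def varMatrix : Matrix (Fin n) (Fin n) ℝ :=
  𝓑.B - 𝓑.posteriorCov

/-- The maximum-DOFS projector `Π_dof = B^{1/2} V_k V_kᵀ B^{-1/2}`, where `V_k` consists of the
first `k` columns of `V`. -/
def dofProjector (V : Matrix (Fin n) (Fin n) ℝ) (k : ℕ) : Matrix (Fin n) (Fin n) ℝ :=
  matSqrt 𝓑.B * (∑ i : Fin n with i.val < k, vecMulVec (V.col i) (V.col i)) * (matSqrt 𝓑.B)⁻¹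

/-- The posterior mean `xᵃ_{Π_dof}` of the maximum-DOFS projected problem. -/
def xDof (V : Matrix (Fin n) (Fin n) ℝ) (k : ℕ) (d : EuclideanSpace ℝ (Fin p)) :
    EuclideanSpace ℝ (Fin n) :=
  (𝓑.projected (𝓑.dofProjector V k)).posteriorMean d

/-- The low-rank update approximation
`B - B^{1/2} (∑_{i ≤ k} lam_i (1 + lam_i)⁻¹ v_i v_iᵀ) B^{1/2}` of `Pᵃ`. -/
def dofCov (V : Matrix (Fin n) (Fin n) ℝ) (lam : Fin n → ℝ) (k : ℕ) :
    Matrix (Fin n) (Fin n) ℝ :=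
  𝓑.B - matSqrt 𝓑.B *
    (∑ i : Fin n with i.val < k, (lam i * (1 + lam i)⁻¹) • vecMulVec (V.col i) (V.col i)) *
      matSqrt 𝓑.B

/-- The full-rank approximation `xᵃ_{FR_dof}` of the posterior mean: the approximation above of
`Pᵃ`, applied to `Hᵀ R⁻¹ d`. -/
def xFRDof (V : Matrix (Fin n) (Fin n) ℝ) (lam : Fin n → ℝ) (k : ℕ)
    (d : EuclideanSpace ℝ (Fin p)) : EuclideanSpace ℝ (Fin n) :=
  act (𝓑.dofCov V lam k * 𝓑.Hᵀ * 𝓑.R⁻¹) d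

/-- `z_i = δ_i^{-1/2} (H B Hᵀ + R)^{-1/2} H B u_i`, the right singular vector of
`B Hᵀ (H B Hᵀ + R)^{-1/2}` that is paired with the left singular vector `u_i`
(and `0` if `δ_i = 0`). -/
def rightSingularVector (U : Matrix (Fin n) (Fin n) ℝ) (δ : Fin n → ℝ) (i : Fin n) :
    Fin p → ℝ :=
  (Real.sqrt (δ i))⁻¹ • ((matSqrt 𝓑.innovationCov)⁻¹ * 𝓑.H * 𝓑.B) *ᵥ U.col i

/-- The gain matrix `(∑_{i ≤ k} δ_i^{1/2} u_i z_iᵀ) (H B Hᵀ + R)^{-1/2}`. -/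
def varGain (U : Matrix (Fin n) (Fin n) ℝ) (δ : Fin n → ℝ) (k : ℕ) :
    Matrix (Fin n) (Fin p) ℝ :=
  (∑ i : Fin n with i.val < k,
      Real.sqrt (δ i) • vecMulVec (U.col i) (𝓑.rightSingularVector U δ i)) *
    (matSqrt 𝓑.innovationCov)⁻¹

/-- The approximation `xᵃ_var` of the posterior mean. -/
def xVar (U : Matrix (Fin n) (Fin n) ℝ) (δ : Fin n → ℝ) (k : ℕ)
    (d : EuclideanSpace ℝ (Fin p)) : EuclideanSpace ℝ (Fin n) :=
  act (𝓑.varGain U δ k) d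

end BayesianProblem

end

/-!
All five objectives are quadratic. Since the innovation `d` is centred with covariance
`Y = H B Hᵀ + R`, a weight `W = Sᵀ S` gives `𝔼 ‖M d‖_W² = tr (S M Y Mᵀ Sᵀ)`
(`integral_norm_act_innovation_sq`), which is the squared Frobenius norm of `S M Y^{1/2}`.
Minimising over `M = N - C` with `rank N ≤ k` is therefore the Eckart–Young problem for
`A = S C Y^{1/2}`. If `S` is chosen such that `A Aᵀ` is diagonal with nonincreasing entries `μ`, then
the minimum is `∑_{i ≥ k} μ i`, and every `N` such that `S N` consists of the first `k` rows of `S C`,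
followed by zeros, attains it (`sum_tail_le_trace_sub`, `isLeast_trace_of_truncation`).

For the Euclidean norm, `S = Uᵀ` does this, because the posterior mean `K d` has covariance
`K Y Kᵀ = B - Pᵃ = Q_var` (`gain_mul_innovationCov_mul_transpose`).
For the other norms, `E = B^{1/2} V` and `E⁻¹ = Vᵀ B^{-1/2}` diagonalise the problem:
`B = E Eᵀ`, `Hᵀ R⁻¹ H = E⁻ᵀ Λ E⁻¹` and `Pᵃ = E (1 + Λ)⁻¹ Eᵀ`. Hence `S = w^{1/2} E⁻¹` is a root
of `B⁻¹` for `w = 1` and of `(Pᵃ)⁻¹` for `w = 1 + Λ`. The covariance of `S K d` is `w Λ / (1 + Λ)`.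
Because of the representativeness error, projecting the Bayesian problem by `Π_dof` leaves `Y`
unchanged, and the projected gain is `Π_dof K` (`gain_projected_dofProjector`); in the coordinates
`E⁻¹` this is the truncation to the first `k` rows. For low-rank updates `P̃ = B - Q Qᵀ` of the
covariance, the low-rank matrix is `(P̃ - B) Hᵀ R⁻¹`, its target is `(Pᵃ - B) Hᵀ R⁻¹`, and the
diagonal is `w (Λ / (1 + Λ))² (Λ + Λ²) = w Λ³ / (1 + Λ)`.

The posterior mean is the conditional expectation because the residual `x - K d` is jointly Gaussian
with `d` and uncorrelated with it, hence independent of it (`condExp_state_innovation`).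
-/

/-! ### Square roots and projections of matrices -/

theorem matSqrt_mul_self {m : ℕ} {S : Matrix (Fin m) (Fin m) ℝ} (hS : S.PosSemidef) :
    matSqrt S * matSqrt S = S := by
  open scoped MatrixOrder in exact CFC.sqrt_mul_sqrt_self S hS.nonneg

theorem matSqrt_transpose {m : ℕ} (S : Matrix (Fin m) (Fin m) ℝ) :
    (matSqrt S)ᵀ = matSqrt S := by
  open scoped MatrixOrder in
  have h := (Matrix.nonneg_iff_posSemidef.1 (CFC.sqrt_nonneg S)).isHermitian
  rwa [IsHermitian, conjTranspose_eq_transpose_of_trivial] at h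

theorem isUnit_det_matSqrt {m : ℕ} {S : Matrix (Fin m) (Fin m) ℝ} (hS : S.PosDef) :
    IsUnit (matSqrt S).det := by
  have h := congrArg det (matSqrt_mul_self hS.posSemidef)
  rw [det_mul] at h
  exact isUnit_of_mul_isUnit_left (h ▸ (isUnit_iff_isUnit_det S).1 hS.isUnit)

/-- The coordinate projection onto the first `k` coordinates. -/
noncomputable def coordProj (m k : ℕ) : Matrix (Fin m) (Fin m) ℝ :=
  diagonal fun i => if i.val < k then 1 else 0

theorem rank_coordProj_le (m k : ℕ) : (coordProj m k).rank ≤ k := by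
  classical
  rw [coordProj, rank_diagonal]
  let f : {i : Fin m // (if i.val < k then (1 : ℝ) else 0) ≠ 0} → Fin k := fun i =>
    ⟨i.1.val, by by_contra h; exact i.2 (if_neg h)⟩
  have hf : Function.Injective f := fun a b hab => by
    simpa [f, Subtype.ext_iff, Fin.ext_iff] using hab
  simpa using Fintype.card_le_of_injective f hf

theorem sum_smul_vecMulVec_col {m k : ℕ} (V : Matrix (Fin m) (Fin m) ℝ) (c : Fin m → ℝ) :
    ∑ i : Fin m with i.val < k, c i • vecMulVec (V.col i) (V.col i)
      = V * (coordProj m k * diagonal c) * Vᵀ := by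
  ext a b
  rw [coordProj, diagonal_mul_diagonal, mul_apply, Matrix.sum_apply, Finset.sum_filter]
  simp only [mul_diagonal, Matrix.smul_apply, vecMulVec_apply, smul_eq_mul, col_apply,
    transpose_apply]
  exact Finset.sum_congr rfl fun i _ => by split_ifs <;> ring

theorem trace_mul_transpose_nonneg {m l : ℕ} (X : Matrix (Fin m) (Fin l) ℝ) :
    0 ≤ (X * Xᵀ).trace := by
  simp only [trace, diag, mul_apply, transpose_apply]
  exact Finset.sum_nonneg fun i _ => Finset.sum_nonneg fun j _ => mul_self_nonneg _

/-- The orthogonal projection onto the column space of `M`; it is the spectral projection of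
`M Mᵀ` away from the kernel. -/
theorem exists_projection_range {m l : ℕ} (M : Matrix (Fin m) (Fin l) ℝ) :
    ∃ F : Matrix (Fin m) (Fin m) ℝ, Fᵀ = F ∧ F * F = F ∧ F * M = M ∧ F.trace = M.rank := by
  classical
  have hM : (M * Mᵀ).IsHermitian := by
    simpa using isHermitian_mul_conjTranspose_self M
  obtain ⟨W, ev, hW, hWM, hrank⟩ : ∃ (W : Matrix (Fin m) (Fin m) ℝ) (ev : Fin m → ℝ),
      Wᵀ * W = 1 ∧ M * Mᵀ = W * diagonal ev * Wᵀ ∧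
        (M * Mᵀ).rank = Fintype.card {i // ev i ≠ 0} := by
    refine ⟨hM.eigenvectorUnitary, hM.eigenvalues, ?_, ?_, hM.rank_eq_card_non_zero_eigs⟩
    · have := Unitary.coe_star_mul_self hM.eigenvectorUnitary
      simpa [star_eq_conjTranspose, conjTranspose_eq_transpose_of_trivial] using this
    · have := hM.spectral_theorem
      rw [Unitary.conjStarAlgAut_apply] at this
      simpa [star_eq_conjTranspose, conjTranspose_eq_transpose_of_trivial, Function.comp_def]
        using this
  let e : Fin m → ℝ := fun i => if ev i ≠ 0 then 1 else 0
  have hee : diagonal e * diagonal e = diagonal e := by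
    rw [diagonal_mul_diagonal]; congr 1; ext i; simp only [e]; split_ifs <;> simp
  have hev : diagonal e * diagonal ev = diagonal ev := by
    rw [diagonal_mul_diagonal]; congr 1; ext i; simp only [e]; split_ifs with h
    · simp
    · simpa using (not_not.1 h).symm
  have hF : (W * diagonal e * Wᵀ) * (M * Mᵀ) = M * Mᵀ := by
    rw [hWM]
    calc _ = W * (diagonal e * (Wᵀ * W) * diagonal ev) * Wᵀ := by noncomm_ring
      _ = _ := by rw [hW, mul_one, hev]
  refine ⟨W * diagonal e * Wᵀ, ?_, ?_, ?_, ?_⟩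
  · simp [Matrix.mul_assoc]
  · calc _ = W * (diagonal e * (Wᵀ * W) * diagonal e) * Wᵀ := by noncomm_ring
      _ = _ := by rw [hW, mul_one, hee]
  · set F := W * diagonal e * Wᵀ
    have h0 : (M - F * M) * (M - F * M)ᴴ = 0 := by
      have : (M - F * M) * (M - F * M)ᴴ = (M * Mᵀ - F * (M * Mᵀ)) * (1 - F)ᵀ := by
        simp [conjTranspose_eq_transpose_of_trivial, Matrix.sub_mul, Matrix.mul_sub,
          Matrix.mul_assoc]
      rw [this, hF, sub_self, Matrix.zero_mul]
    exact (sub_eq_zero.1 (self_mul_conjTranspose_eq_zero.1 h0)).symm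
  · rw [Matrix.trace_mul_comm, ← Matrix.mul_assoc, hW, Matrix.one_mul, trace_diagonal,
      ← rank_self_mul_transpose M, hrank, Fintype.card_subtype]
    simp [e, Finset.sum_ite]

/-! ### Low-rank approximation -/

/-- Weights `f i ∈ [0, 1]` of total mass at most `k` capture no more of a nonincreasing sequence
`μ` than its first `k` terms do. -/
theorem sum_tail_le_sum_one_sub_mul {m k : ℕ} {μ f : Fin m → ℝ} (hμ : Antitone μ)
    (hμ0 : ∀ i, 0 ≤ μ i) (hf0 : ∀ i, 0 ≤ f i) (hf1 : ∀ i, f i ≤ 1) (hf : ∑ i, f i ≤ k) :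
    ∑ i : Fin m with k ≤ i.val, μ i ≤ ∑ i, (1 - f i) * μ i := by
  rcases le_or_gt m k with hmk | hkm
  · rw [Finset.filter_false_of_mem fun i _ => by have := i.2; omega, Finset.sum_empty]
    exact Finset.sum_nonneg fun i _ => mul_nonneg (sub_nonneg.2 (hf1 i)) (hμ0 i)
  -- compare all eigenvalues with the threshold value `c = μ k`
  set c := μ ⟨k, hkm⟩
  have hcard : ∑ i : Fin m, (if i.val < k then (1 : ℝ) else 0) = k := by
    have hmin : ({i : Fin m | i.val < k} : Finset (Fin m)) = Finset.Iio ⟨k, hkm⟩ := by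
      ext i; simp [Fin.lt_def]
    rw [Finset.sum_boole, hmin, Fin.card_Iio]
  have key : ∀ i : Fin m, (if k ≤ i.val then μ i else 0) +
      c * ((if i.val < k then (1 : ℝ) else 0) - f i) ≤ (1 - f i) * μ i := by
    intro i
    rcases lt_or_ge i.val k with h | h
    · have : c ≤ μ i := hμ (Fin.le_def.2 h.le)
      rw [if_neg (by omega), if_pos h, zero_add, mul_comm]
      exact mul_le_mul_of_nonneg_left this (sub_nonneg.2 (hf1 i))
    · have : μ i ≤ c := hμ (Fin.le_def.2 h)
      rw [if_pos h, if_neg (by omega)]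
      nlinarith [mul_le_mul_of_nonneg_left this (hf0 i)]
  have hs := Finset.sum_le_sum fun i (_ : i ∈ Finset.univ) => key i
  rw [Finset.sum_add_distrib, ← Finset.mul_sum, Finset.sum_sub_distrib, hcard,
    ← Finset.sum_filter] at hs
  nlinarith [mul_nonneg (hμ0 ⟨k, hkm⟩) (sub_nonneg.2 hf)]

/-- The Eckart–Young inequality for the Frobenius norm, in a left singular basis of `A`. With `F`
the projection onto the range of `N`, the part `(1 - F) (N - A) = -(1 - F) A` of the error does not
depend on `N`, and the diagonal of `F` is a weight of mass `rank N`. -/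
theorem sum_tail_le_trace_sub {m l k : ℕ} {A N : Matrix (Fin m) (Fin l) ℝ} {μ : Fin m → ℝ}
    (hA : A * Aᵀ = diagonal μ) (hμ : Antitone μ) (hN : N.rank ≤ k) :
    ∑ i : Fin m with k ≤ i.val, μ i ≤ ((N - A) * (N - A)ᵀ).trace := by
  obtain ⟨F, hFt, hFF, hFN, htr⟩ := exists_projection_range N
  have hdiag : ∀ i, F i i = ∑ j, F i j ^ 2 := fun i => by
    have h := congrFun (congrFun hFF i) i
    rw [mul_apply] at h
    rw [← h]
    refine Finset.sum_congr rfl fun j _ => ?_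
    have : F j i = F i j := congrFun (congrFun hFt i) j
    rw [this, sq]
  have h0 : ∀ i, 0 ≤ F i i := fun i => by
    rw [hdiag]; exact Finset.sum_nonneg fun j _ => sq_nonneg _
  have h1 : ∀ i, F i i ≤ 1 := fun i => by
    have : F i i ^ 2 ≤ F i i := by
      conv_rhs => rw [hdiag]
      exact Finset.single_le_sum (f := fun j => F i j ^ 2) (fun j _ => sq_nonneg _)
        (Finset.mem_univ i)
    nlinarith
  have hμ0 : ∀ i, 0 ≤ μ i := fun i => by
    have h := congrFun (congrFun hA i) i
    rw [diagonal_apply_eq, mul_apply] at h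
    rw [← h]
    exact Finset.sum_nonneg fun j _ => mul_self_nonneg _
  have hsum : ∑ i, F i i ≤ k := by
    have : ∑ i, F i i = N.rank := htr
    rw [this]; exact_mod_cast hN
  refine (sum_tail_le_sum_one_sub_mul hμ hμ0 h0 h1 hsum).trans ?_
  -- off the range of `N`, the difference `N - A` is `-A`
  have hoff : (1 - F) * (N - A) = -((1 - F) * A) := by
    rw [Matrix.mul_sub, Matrix.sub_mul 1 F N, hFN, Matrix.one_mul, sub_self, zero_sub]
  have hidem : (1 - F) * (1 - F) = 1 - F := by
    rw [Matrix.mul_sub, Matrix.sub_mul, Matrix.sub_mul, hFF]; simp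
  have hsplit : ∀ X : Matrix (Fin m) (Fin l) ℝ, ∀ G : Matrix (Fin m) (Fin m) ℝ, Gᵀ = G →
      G * G = G → ((G * X) * (G * X)ᵀ).trace = (G * (X * Xᵀ)).trace := by
    intro X G hG hGG
    rw [transpose_mul, hG, ← Matrix.mul_assoc, Matrix.trace_mul_comm, Matrix.mul_assoc G X,
      ← Matrix.mul_assoc G G, hGG]
  have ht : (1 - F)ᵀ = 1 - F := by rw [transpose_sub, transpose_one, hFt]
  have e1 := hsplit (N - A) F hFt hFF
  have e2 := hsplit (N - A) (1 - F) ht hidem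
  have e3 := hsplit A (1 - F) ht hidem
  rw [hoff, transpose_neg, Matrix.neg_mul, Matrix.mul_neg, neg_neg, e3] at e2
  have e4 : ((1 - F) * (A * Aᵀ)).trace = ∑ i, (1 - F i i) * μ i := by
    rw [hA]; simp [trace, mul_diagonal]
  have e5 := trace_mul_transpose_nonneg (F * (N - A))
  rw [Matrix.sub_mul 1 F ((N - A) * _), Matrix.one_mul, trace_sub] at e2
  linarith

/-- Low-rank approximation of `C` in the quadratic functional `M ↦ tr (S (M - C) Y (M - C)ᵀ Sᵀ)`:
if `S C Y Cᵀ Sᵀ` is diagonal with nonincreasing entries `μ`, then a family of matrices of rank at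
most `k` is optimised by any member whose image under `S` is the truncation of `S C` to its first
`k` rows, and the minimum is the tail sum of `μ`. -/
theorem isLeast_trace_of_truncation {m l k : ℕ} {ι : Type*} {S : Matrix (Fin m) (Fin m) ℝ}
    {Y : Matrix (Fin l) (Fin l) ℝ} (hY : Y.PosSemidef) {C : Matrix (Fin m) (Fin l) ℝ}
    {μ : Fin m → ℝ} (hC : S * C * Y * (S * C)ᵀ = diagonal μ) (hμ : Antitone μ)
    (N : ι → Matrix (Fin m) (Fin l) ℝ) {𝓒 : Set ι} (hN : ∀ j ∈ 𝓒, (N j).rank ≤ k)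
    {j₀ : ι} (hj₀ : j₀ ∈ 𝓒) (hopt : S * N j₀ = coordProj m k * (S * C)) :
    IsLeast ((fun j => (S * (N j - C) * Y * (S * (N j - C))ᵀ).trace) '' 𝓒)
        (S * (N j₀ - C) * Y * (S * (N j₀ - C))ᵀ).trace ∧
      (S * (N j₀ - C) * Y * (S * (N j₀ - C))ᵀ).trace = ∑ i : Fin m with k ≤ i.val, μ i := by
  have hval : (S * (N j₀ - C) * Y * (S * (N j₀ - C))ᵀ).trace
      = ∑ i : Fin m with k ≤ i.val, μ i := by
    have h1 : S * (N j₀ - C) = (coordProj m k - 1) * (S * C) := by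
      rw [Matrix.mul_sub, hopt, Matrix.sub_mul, Matrix.one_mul]
    have h2 : S * (N j₀ - C) * Y * (S * (N j₀ - C))ᵀ
        = (coordProj m k - 1) * diagonal μ * (coordProj m k - 1)ᵀ := by
      rw [h1, transpose_mul, ← hC]; simp only [Matrix.mul_assoc]
    have h3 : coordProj m k - 1
        = diagonal fun i : Fin m => if i.val < k then (0 : ℝ) else -1 := by
      rw [coordProj, ← diagonal_one, diagonal_sub]
      congr 1; ext i; split_ifs <;> simp
    rw [h2, h3, diagonal_transpose, diagonal_mul_diagonal, diagonal_mul_diagonal,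
      trace_diagonal, Finset.sum_filter]
    refine Finset.sum_congr rfl fun i _ => ?_
    by_cases h : i.val < k
    · simp [h, Nat.not_le.2 h]
    · simp [h, Nat.not_lt.1 h]
  refine ⟨⟨⟨j₀, hj₀, rfl⟩, ?_⟩, hval⟩
  rintro _ ⟨j, hj, rfl⟩
  have hfac : ∀ X : Matrix (Fin m) (Fin l) ℝ,
      X * Y * Xᵀ = (X * matSqrt Y) * (X * matSqrt Y)ᵀ := fun X => by
    conv_lhs => rw [← matSqrt_mul_self hY]
    rw [transpose_mul, matSqrt_transpose]; simp only [Matrix.mul_assoc]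
  have hrank : (S * N j * matSqrt Y).rank ≤ k :=
    (rank_mul_le_left _ _).trans ((rank_mul_le_right _ _).trans (hN j hj))
  have := sum_tail_le_trace_sub ((hfac _).symm.trans hC) hμ hrank
  dsimp only
  rw [hval, hfac]
  rwa [← Matrix.sub_mul, ← Matrix.mul_sub] at this

open scoped RealInnerProductSpace

/-! ### The action of matrices on Euclidean vectors -/

/-- `act M` as a continuous linear map. -/
noncomputable def actCLM {m l : ℕ} (M : Matrix (Fin m) (Fin l) ℝ) :
    EuclideanSpace ℝ (Fin l) →L[ℝ] EuclideanSpace ℝ (Fin m) :=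
  LinearMap.toContinuousLinearMap (Matrix.toEuclideanLin M)

theorem actCLM_apply {m l : ℕ} (M : Matrix (Fin m) (Fin l) ℝ) (x : EuclideanSpace ℝ (Fin l)) :
    actCLM M x = act M x := rfl

theorem act_act {m l q : ℕ} (S : Matrix (Fin m) (Fin l) ℝ) (M : Matrix (Fin l) (Fin q) ℝ)
    (x : EuclideanSpace ℝ (Fin q)) : act S (act M x) = act (S * M) x := by
  simp [act, mulVec_mulVec]

theorem act_sub_act {m l : ℕ} (M N : Matrix (Fin m) (Fin l) ℝ) (x : EuclideanSpace ℝ (Fin l)) :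
    act M x - act N x = act (M - N) x := by
  simp [act, sub_mulVec]

theorem inner_act_right {m l : ℕ} (M : Matrix (Fin m) (Fin l) ℝ) (a : EuclideanSpace ℝ (Fin m))
    (x : EuclideanSpace ℝ (Fin l)) : ⟪a, act M x⟫ = ⟪act Mᵀ a, x⟫ := by
  simp only [act, EuclideanSpace.inner_eq_star_dotProduct, star_trivial]
  rw [mulVec_transpose, dotProduct_comm, dotProduct_mulVec, dotProduct_comm]

theorem weightedNorm_sq_act {m l : ℕ} {W S : Matrix (Fin m) (Fin m) ℝ} (hW : W = Sᵀ * S)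
    (M : Matrix (Fin m) (Fin l) ℝ) (x : EuclideanSpace ℝ (Fin l)) :
    weightedNorm W (act M x) ^ 2 = ‖act (S * M) x‖ ^ 2 := by
  have h : (act M x).ofLp ⬝ᵥ (W *ᵥ (act M x).ofLp) = ‖act (S * M) x‖ ^ 2 := by
    rw [← act_act, ← real_inner_self_eq_norm_sq, EuclideanSpace.inner_eq_star_dotProduct, hW,
      ← mulVec_mulVec, dotProduct_mulVec, vecMul_transpose]
    rfl
  rw [weightedNorm, h, Real.sq_sqrt (sq_nonneg _)]

/-! ### Second moments of the innovation -/

theorem inner_innovation {Ω : Type*} {n p : ℕ} {H : Matrix (Fin p) (Fin n) ℝ}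
    {x : Ω → EuclideanSpace ℝ (Fin n)} {ε d : Ω → EuclideanSpace ℝ (Fin p)}
    (hd : ∀ ω, d ω = act H (x ω) + ε ω)
    (b : EuclideanSpace ℝ (Fin p)) :
    (fun ω => ⟪b, d ω⟫) = (fun ω => ⟪act Hᵀ b, x ω⟫) + fun ω => ⟪b, ε ω⟫ := by
  ext ω
  simp [hd, inner_add_right, inner_act_right]

section Gaussian

variable {Ω : Type*} [MeasurableSpace Ω] {P : Measure Ω} {n p : ℕ}

theorem covariance_inner_of_hasLaw [IsProbabilityMeasure P] {x : Ω → EuclideanSpace ℝ (Fin n)}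
    {B : Matrix (Fin n) (Fin n) ℝ} (hB : B.PosSemidef)
    (hx : HasLaw x (multivariateGaussian 0 B) P) (a b : EuclideanSpace ℝ (Fin n)) :
    cov[fun ω => ⟪a, x ω⟫, fun ω => ⟪b, x ω⟫; P] = a.ofLp ⬝ᵥ B *ᵥ b.ofLp := by
  rw [← covarianceBilin_multivariateGaussian (μ := 0) hB a b, covarianceBilin_apply_eq_cov
    IsGaussian.memLp_two_id, ← hx.map_eq, covariance_map (by fun_prop) (by fun_prop)
    hx.aemeasurable]
  rfl

theorem integral_eq_zero_of_hasLaw {x : Ω → EuclideanSpace ℝ (Fin n)}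
    {B : Matrix (Fin n) (Fin n) ℝ} (hx : HasLaw x (multivariateGaussian 0 B) P) :
    ∫ ω, x ω ∂P = 0 := by
  have h := integral_id_multivariateGaussian (μ := 0) (S := B)
  rw [← hx.map_eq, integral_map hx.aemeasurable (by fun_prop)] at h
  exact h

variable {B : Matrix (Fin n) (Fin n) ℝ} {R : Matrix (Fin p) (Fin p) ℝ}
  {H : Matrix (Fin p) (Fin n) ℝ} {x : Ω → EuclideanSpace ℝ (Fin n)}
  {ε d : Ω → EuclideanSpace ℝ (Fin p)}

theorem hasGaussianLaw_state_innovation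
    (hx : HasLaw x (multivariateGaussian 0 B) P) (hε : HasLaw ε (multivariateGaussian 0 R) P)
    (hind : IndepFun x ε P) (hd : ∀ ω, d ω = act H (x ω) + ε ω) :
    HasGaussianLaw (fun ω => (x ω, d ω)) P := by
  have hj := hind.hasGaussianLaw hx.hasGaussianLaw hε.hasGaussianLaw
  have := hj.map_fun ((ContinuousLinearMap.fst ℝ _ _).prod
    ((actCLM H).comp (ContinuousLinearMap.fst ℝ _ _) + ContinuousLinearMap.snd ℝ _ _))
  simpa [actCLM_apply, ← hd] using this

theorem covariance_state_innovation [IsProbabilityMeasure P] (hB : B.PosSemidef)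
    (hx : HasLaw x (multivariateGaussian 0 B) P) (hε : HasLaw ε (multivariateGaussian 0 R) P)
    (hind : IndepFun x ε P) (hd : ∀ ω, d ω = act H (x ω) + ε ω)
    (a : EuclideanSpace ℝ (Fin n)) (b : EuclideanSpace ℝ (Fin p)) :
    cov[fun ω => ⟪a, x ω⟫, fun ω => ⟪b, d ω⟫; P] = a.ofLp ⬝ᵥ (B * Hᵀ) *ᵥ b.ofLp := by
  have mx : ∀ a, MemLp (fun ω => ⟪a, x ω⟫) 2 P := fun a =>
    (hx.hasGaussianLaw.map_fun (innerSL ℝ a)).memLp_two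
  have mε : ∀ a, MemLp (fun ω => ⟪a, ε ω⟫) 2 P := fun a =>
    (hε.hasGaussianLaw.map_fun (innerSL ℝ a)).memLp_two
  have h0 : cov[fun ω => ⟪a, x ω⟫, fun ω => ⟪b, ε ω⟫; P] = 0 :=
    (hind.comp (φ := fun y => ⟪a, y⟫) (ψ := fun y => ⟪b, y⟫) (by fun_prop)
      (by fun_prop)).covariance_eq_zero (mx a) (mε b)
  rw [inner_innovation hd, covariance_add_right (mx a) (mx _) (mε b),
    covariance_inner_of_hasLaw hB hx, h0, add_zero, ← mulVec_mulVec]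
  rfl

theorem covariance_innovation [IsProbabilityMeasure P] (hB : B.PosSemidef) (hR : R.PosSemidef)
    (hx : HasLaw x (multivariateGaussian 0 B) P) (hε : HasLaw ε (multivariateGaussian 0 R) P)
    (hind : IndepFun x ε P) (hd : ∀ ω, d ω = act H (x ω) + ε ω)
    (a b : EuclideanSpace ℝ (Fin p)) :
    cov[fun ω => ⟪a, d ω⟫, fun ω => ⟪b, d ω⟫; P]
      = a.ofLp ⬝ᵥ (H * B * Hᵀ + R) *ᵥ b.ofLp := by
  have mx : ∀ a, MemLp (fun ω => ⟪a, x ω⟫) 2 P := fun a =>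
    (hx.hasGaussianLaw.map_fun (innerSL ℝ a)).memLp_two
  have mε : ∀ a, MemLp (fun ω => ⟪a, ε ω⟫) 2 P := fun a =>
    (hε.hasGaussianLaw.map_fun (innerSL ℝ a)).memLp_two
  have md : MemLp (fun ω => ⟪b, d ω⟫) 2 P :=
    ((hasGaussianLaw_state_innovation hx hε hind hd).snd.map_fun (innerSL ℝ b)).memLp_two
  have h0 : cov[fun ω => ⟪a, ε ω⟫, fun ω => ⟪act Hᵀ b, x ω⟫; P] = 0 :=
    (hind.symm.comp (φ := fun y => ⟪a, y⟫) (ψ := fun y => ⟪act Hᵀ b, y⟫) (by fun_prop)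
      (by fun_prop)).covariance_eq_zero (mε a) (mx _)
  rw [inner_innovation hd a, covariance_add_left (mx _) (mε a) md,
    covariance_state_innovation hB hx hε hind hd, inner_innovation hd b,
    covariance_add_right (mε a) (mx _) (mε b), h0, covariance_inner_of_hasLaw hR hε, zero_add,
    add_mulVec, dotProduct_add, Matrix.mul_assoc, ← mulVec_mulVec (v := b.ofLp) (M := H),
    dotProduct_mulVec _ H, ← mulVec_transpose H]
  rfl

theorem integral_innovation (hx : HasLaw x (multivariateGaussian 0 B) P)
    (hε : HasLaw ε (multivariateGaussian 0 R) P) (hd : ∀ ω, d ω = act H (x ω) + ε ω) :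
    ∫ ω, d ω ∂P = 0 := by
  have ix : Integrable (fun ω => actCLM H (x ω)) P :=
    (hx.hasGaussianLaw.map_fun (actCLM H)).integrable
  simp_rw [hd, ← actCLM_apply]
  rw [integral_add ix hε.hasGaussianLaw.integrable, integral_eq_zero_of_hasLaw hε, add_zero]
  rw [ContinuousLinearMap.integral_comp_comm _ hx.hasGaussianLaw.integrable,
    integral_eq_zero_of_hasLaw hx, map_zero]

theorem integral_norm_act_innovation_sq [IsProbabilityMeasure P] {q : ℕ}
    (hB : B.PosSemidef) (hR : R.PosSemidef)
    (hx : HasLaw x (multivariateGaussian 0 B) P) (hε : HasLaw ε (multivariateGaussian 0 R) P)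
    (hind : IndepFun x ε P) (hd : ∀ ω, d ω = act H (x ω) + ε ω)
    (M : Matrix (Fin q) (Fin p) ℝ) :
    ∫ ω, ‖act M (d ω)‖ ^ 2 ∂P = (M * (H * B * Hᵀ + R) * Mᵀ).trace := by
  have hdG := (hasGaussianLaw_state_innovation hx hε hind hd).snd
  have md : ∀ a, MemLp (fun ω => ⟪a, d ω⟫) 2 P := fun a =>
    (hdG.map_fun (innerSL ℝ a)).memLp_two
  have hmean : ∀ a, ∫ ω, ⟪a, d ω⟫ ∂P = 0 := fun a => by
    rw [integral_inner hdG.integrable, integral_innovation hx hε hd, inner_zero_right]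
  have hrow : ∀ ω, ‖act M (d ω)‖ ^ 2 = ∑ i, ⟪WithLp.toLp 2 (M i), d ω⟫ ^ 2 := fun ω => by
    rw [EuclideanSpace.real_norm_sq_eq]
    refine Finset.sum_congr rfl fun i _ => ?_
    rw [EuclideanSpace.inner_eq_star_dotProduct, star_trivial, dotProduct_comm]
    rfl
  simp_rw [hrow]
  rw [integral_finsetSum _ fun i _ => (md _).integrable_sq, trace]
  refine Finset.sum_congr rfl fun i _ => ?_
  have h := covariance_innovation hB hR hx hε hind hd (WithLp.toLp 2 (M i)) (WithLp.toLp 2 (M i))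
  rw [covariance_eq_sub (md _) (md _), hmean, zero_mul, sub_zero] at h
  have ht : (M * (H * B * Hᵀ + R) * Mᵀ).diag i = M i ⬝ᵥ (H * B * Hᵀ + R) *ᵥ M i := by
    rw [diag_apply, Matrix.mul_assoc]
    rfl
  rw [ht]
  simpa [sq] using h

theorem integrable_norm_act_innovation_sq {q : ℕ}
    (hx : HasLaw x (multivariateGaussian 0 B) P) (hε : HasLaw ε (multivariateGaussian 0 R) P)
    (hind : IndepFun x ε P) (hd : ∀ ω, d ω = act H (x ω) + ε ω)
    (M : Matrix (Fin q) (Fin p) ℝ) :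
    Integrable (fun ω => ‖act M (d ω)‖ ^ 2) P :=
  (((hasGaussianLaw_state_innovation hx hε hind hd).snd.map_fun
    (actCLM M)).memLp_two).integrable_norm_pow two_ne_zero

/-- Gaussian conditioning: if `K` solves the normal equations `K Y = B Hᵀ`, the residual `x - K d`
is uncorrelated with `d`, hence independent of it, and `K d` is the conditional mean. -/
theorem condExp_state_innovation [IsProbabilityMeasure P] (hB : B.PosSemidef) (hR : R.PosSemidef)
    (hxm : Measurable x) (hεm : Measurable ε)
    (hx : HasLaw x (multivariateGaussian 0 B) P) (hε : HasLaw ε (multivariateGaussian 0 R) P)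
    (hind : IndepFun x ε P) (hd : ∀ ω, d ω = act H (x ω) + ε ω)
    {K : Matrix (Fin n) (Fin p) ℝ} (hK : K * (H * B * Hᵀ + R) = B * Hᵀ) :
    (fun ω => act K (d ω)) =ᵐ[P] P[x | MeasurableSpace.comap d inferInstance] := by
  have hdm : Measurable d := by
    have : d = fun ω => actCLM H (x ω) + ε ω := funext hd
    rw [this]; fun_prop
  have hj := hasGaussianLaw_state_innovation hx hε hind hd
  have mx : ∀ a, MemLp (fun ω => ⟪a, x ω⟫) 2 P := fun a =>
    (hx.hasGaussianLaw.map_fun (innerSL ℝ a)).memLp_two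
  have md : ∀ a, MemLp (fun ω => ⟪a, d ω⟫) 2 P := fun a =>
    (hj.snd.map_fun (innerSL ℝ a)).memLp_two
  set r : Ω → EuclideanSpace ℝ (Fin n) := fun ω => x ω - actCLM K (d ω)
  have hrm : Measurable r := by fun_prop
  have hrd : HasGaussianLaw (fun ω => (r ω, d ω)) P := by
    have := hj.map_fun ((ContinuousLinearMap.fst ℝ _ _ -
      (actCLM K).comp (ContinuousLinearMap.snd ℝ _ _)).prod (ContinuousLinearMap.snd ℝ _ _))
    simpa [r] using this
  have hrind : IndepFun r d P := by
    refine hrd.indepFun_of_covariance_inner fun a b => ?_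
    have hra : (fun ω => ⟪a, r ω⟫) = (fun ω => ⟪a, x ω⟫) - fun ω => ⟪act Kᵀ a, d ω⟫ := by
      ext ω
      simp [r, inner_sub_right, actCLM_apply, inner_act_right]
    rw [hra, covariance_sub_left (mx a) (md _) (md b), covariance_state_innovation hB hx hε hind hd,
      covariance_innovation hB hR hx hε hind hd, ← hK, ← mulVec_mulVec, dotProduct_mulVec _ K,
      ← mulVec_transpose K]
    exact sub_self _
  have hr0 : ∫ ω, r ω ∂P = 0 := by
    have hKd : Integrable (fun ω => actCLM K (d ω)) P := (hj.snd.map_fun (actCLM K)).integrable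
    rw [integral_sub hx.hasGaussianLaw.integrable hKd,
      ContinuousLinearMap.integral_comp_comm _ hj.snd.integrable, integral_eq_zero_of_hasLaw hx,
      integral_innovation hx hε hd, map_zero, sub_zero]
  have hle : MeasurableSpace.comap d inferInstance ≤ (inferInstance : MeasurableSpace Ω) :=
    hdm.comap_le
  have h1 : P[r | MeasurableSpace.comap d inferInstance] =ᵐ[P] fun _ => P[r] :=
    condExp_indep_eq hrm.comap_le hle (comap_measurable r).stronglyMeasurable hrind
  have hKd : Integrable (fun ω => actCLM K (d ω)) P := (hj.snd.map_fun (actCLM K)).integrable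
  have h2 : P[fun ω => actCLM K (d ω) | MeasurableSpace.comap d inferInstance]
      = fun ω => actCLM K (d ω) :=
    condExp_of_stronglyMeasurable hle
      ((actCLM K).continuous.measurable.comp (comap_measurable d)).stronglyMeasurable hKd
  have h3 := condExp_add (m := MeasurableSpace.comap d inferInstance) hrd.fst.integrable hKd
  have hsum : (r + fun ω => actCLM K (d ω)) = x := by ext1 ω; simp [r]
  rw [hsum, h2] at h3
  filter_upwards [h1, h3] with ω e1 e3
  rw [e3, Pi.add_apply, e1, hr0, zero_add]
  rfl

end Gaussian

/-! ### Simultaneous diagonalisation of the prior and the information matrix -/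

namespace BayesianProblem

variable {n p : ℕ} (𝓑 : BayesianProblem n p)

/-- The columns of `B^{1/2} V`: the eigenvectors `V` of the prior-preconditioned Hessian, carried
back to the control space. -/
noncomputable def modes (V : Matrix (Fin n) (Fin n) ℝ) : Matrix (Fin n) (Fin n) ℝ :=
  matSqrt 𝓑.B * V

/-- The coordinates `Vᵀ B^{-1/2}` with respect to `𝓑.modes V`. -/
noncomputable def modeCoords (V : Matrix (Fin n) (Fin n) ℝ) : Matrix (Fin n) (Fin n) ℝ :=
  Vᵀ * (matSqrt 𝓑.B)⁻¹

variable {𝓑} {V : Matrix (Fin n) (Fin n) ℝ} {lam : Fin n → ℝ}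

theorem modeCoords_mul_modes (hB : 𝓑.B.PosDef) (hV : Vᵀ * V = 1) :
    𝓑.modeCoords V * 𝓑.modes V = 1 := by
  have h := nonsing_inv_mul _ (isUnit_det_matSqrt hB)
  rw [modeCoords, modes, Matrix.mul_assoc, ← Matrix.mul_assoc (matSqrt 𝓑.B)⁻¹, h, Matrix.one_mul,
    hV]

theorem modes_mul_modeCoords (hB : 𝓑.B.PosDef) (hV : Vᵀ * V = 1) :
    𝓑.modes V * 𝓑.modeCoords V = 1 :=
  mul_eq_one_comm.1 (modeCoords_mul_modes hB hV)

theorem modes_mul_transpose (hB : 𝓑.B.PosDef) (hV : Vᵀ * V = 1) :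
    𝓑.modes V * (𝓑.modes V)ᵀ = 𝓑.B := by
  rw [modes, transpose_mul, matSqrt_transpose, Matrix.mul_assoc, ← Matrix.mul_assoc V,
    mul_eq_one_comm.1 hV, Matrix.one_mul, matSqrt_mul_self hB.posSemidef]

theorem modes_transpose_mul (hB : 𝓑.B.PosDef) (hV : Vᵀ * V = 1) :
    (𝓑.modes V)ᵀ * (𝓑.modeCoords V)ᵀ = 1 := by
  rw [← transpose_mul, modeCoords_mul_modes hB hV, transpose_one]

theorem modeCoords_transpose_mul (hB : 𝓑.B.PosDef) (hV : Vᵀ * V = 1) :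
    (𝓑.modeCoords V)ᵀ * (𝓑.modes V)ᵀ = 1 := by
  rw [← transpose_mul, modes_mul_modeCoords hB hV, transpose_one]

theorem prior_inv_eq (hB : 𝓑.B.PosDef) (hV : Vᵀ * V = 1) :
    𝓑.B⁻¹ = (𝓑.modeCoords V)ᵀ * 𝓑.modeCoords V := by
  refine inv_eq_right_inv ?_
  rw [← modes_mul_transpose hB hV, Matrix.mul_assoc, ← Matrix.mul_assoc (𝓑.modes V)ᵀ,
    modes_transpose_mul hB hV, Matrix.one_mul, modes_mul_modeCoords hB hV]

theorem information_eq (hB : 𝓑.B.PosDef)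
    (hV : IsEigendecomposition 𝓑.priorPreconditionedHessian V lam) :
    𝓑.Hᵀ * 𝓑.R⁻¹ * 𝓑.H = (𝓑.modeCoords V)ᵀ * diagonal lam * 𝓑.modeCoords V := by
  have hu := isUnit_det_matSqrt hB
  have hG : 𝓑.priorPreconditionedHessian = V * diagonal lam * Vᵀ := by
    rw [← hV.eigen, Matrix.mul_assoc, mul_eq_one_comm.1 hV.orthonormal, Matrix.mul_one]
  calc 𝓑.Hᵀ * 𝓑.R⁻¹ * 𝓑.H
      = ((matSqrt 𝓑.B)⁻¹ * matSqrt 𝓑.B) * (𝓑.Hᵀ * 𝓑.R⁻¹ * 𝓑.H) *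
          (matSqrt 𝓑.B * (matSqrt 𝓑.B)⁻¹) := by
        rw [nonsing_inv_mul _ hu, mul_nonsing_inv _ hu, Matrix.one_mul, Matrix.mul_one]
    _ = (matSqrt 𝓑.B)⁻¹ * 𝓑.priorPreconditionedHessian * (matSqrt 𝓑.B)⁻¹ := by
        simp only [priorPreconditionedHessian, Matrix.mul_assoc]
    _ = _ := by
        rw [hG, modeCoords, transpose_mul, transpose_transpose, transpose_nonsing_inv,
          matSqrt_transpose]
        simp only [Matrix.mul_assoc]

theorem eigenvalue_nonneg (hB : 𝓑.B.PosDef) (hR : 𝓑.R.PosDef)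
    (hV : IsEigendecomposition 𝓑.priorPreconditionedHessian V lam) (i : Fin n) : 0 ≤ lam i := by
  have h : ((𝓑.H * 𝓑.modes V)ᴴ * 𝓑.R⁻¹ * (𝓑.H * 𝓑.modes V)).PosSemidef :=
    hR.inv.posSemidef.conjTranspose_mul_mul_same _
  have e : (𝓑.H * 𝓑.modes V)ᴴ * 𝓑.R⁻¹ * (𝓑.H * 𝓑.modes V) = diagonal lam := by
    rw [conjTranspose_eq_transpose_of_trivial, transpose_mul]
    calc _ = (𝓑.modes V)ᵀ * (𝓑.Hᵀ * 𝓑.R⁻¹ * 𝓑.H) * 𝓑.modes V := by simp only [Matrix.mul_assoc]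
      _ = ((𝓑.modes V)ᵀ * (𝓑.modeCoords V)ᵀ) * diagonal lam *
          (𝓑.modeCoords V * 𝓑.modes V) := by
        rw [information_eq hB hV]; simp only [Matrix.mul_assoc]
      _ = _ := by
        rw [modes_transpose_mul hB hV.orthonormal, modeCoords_mul_modes hB hV.orthonormal,
          Matrix.one_mul, Matrix.mul_one]
  rw [e] at h
  exact (posSemidef_diagonal_iff.1 h) i

theorem precision_eq (hB : 𝓑.B.PosDef)
    (hV : IsEigendecomposition 𝓑.priorPreconditionedHessian V lam) :
    𝓑.B⁻¹ + 𝓑.Hᵀ * 𝓑.R⁻¹ * 𝓑.H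
      = (𝓑.modeCoords V)ᵀ * diagonal (fun i => 1 + lam i) * 𝓑.modeCoords V := by
  have : diagonal (fun i => 1 + lam i) = 1 + diagonal lam := by
    rw [← diagonal_one, diagonal_add]
  rw [prior_inv_eq hB hV.orthonormal, information_eq hB hV, this, Matrix.mul_add, Matrix.add_mul,
    Matrix.mul_one]

/-- The inverse of the posterior precision, written in the modes. -/
theorem precision_mul_modes_congr (hB : 𝓑.B.PosDef) (hR : 𝓑.R.PosDef)
    (hV : IsEigendecomposition 𝓑.priorPreconditionedHessian V lam) :
    (𝓑.B⁻¹ + 𝓑.Hᵀ * 𝓑.R⁻¹ * 𝓑.H) *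
      (𝓑.modes V * diagonal (fun i => (1 + lam i)⁻¹) * (𝓑.modes V)ᵀ) = 1 := by
  have hd : diagonal (fun i => 1 + lam i) * diagonal (fun i => (1 + lam i)⁻¹) = 1 := by
    rw [diagonal_mul_diagonal, ← diagonal_one]
    congr 1; ext i
    have := eigenvalue_nonneg hB hR hV i
    exact mul_inv_cancel₀ (by positivity)
  rw [precision_eq hB hV]
  calc _ = (𝓑.modeCoords V)ᵀ * (diagonal (fun i => 1 + lam i) * (𝓑.modeCoords V * 𝓑.modes V) *
        diagonal (fun i => (1 + lam i)⁻¹)) * (𝓑.modes V)ᵀ := by simp only [Matrix.mul_assoc]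
    _ = 1 := by
      rw [modeCoords_mul_modes hB hV.orthonormal, Matrix.mul_one, hd, Matrix.mul_one,
        modeCoords_transpose_mul hB hV.orthonormal]

theorem posteriorCov_eq (hB : 𝓑.B.PosDef) (hR : 𝓑.R.PosDef)
    (hV : IsEigendecomposition 𝓑.priorPreconditionedHessian V lam) :
    𝓑.posteriorCov = 𝓑.modes V * diagonal (fun i => (1 + lam i)⁻¹) * (𝓑.modes V)ᵀ :=
  inv_eq_right_inv (precision_mul_modes_congr hB hR hV)

theorem precision_mul_posteriorCov (hB : 𝓑.B.PosDef) (hR : 𝓑.R.PosDef)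
    (hV : IsEigendecomposition 𝓑.priorPreconditionedHessian V lam) :
    (𝓑.B⁻¹ + 𝓑.Hᵀ * 𝓑.R⁻¹ * 𝓑.H) * 𝓑.posteriorCov = 1 := by
  rw [posteriorCov_eq hB hR hV, precision_mul_modes_congr hB hR hV]

theorem posteriorCov_inv (hB : 𝓑.B.PosDef) (hR : 𝓑.R.PosDef)
    (hV : IsEigendecomposition 𝓑.priorPreconditionedHessian V lam) :
    𝓑.posteriorCov⁻¹ = 𝓑.B⁻¹ + 𝓑.Hᵀ * 𝓑.R⁻¹ * 𝓑.H :=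
  inv_eq_left_inv (precision_mul_posteriorCov hB hR hV)

theorem prior_sub_posteriorCov_eq (hB : 𝓑.B.PosDef) (hR : 𝓑.R.PosDef)
    (hV : IsEigendecomposition 𝓑.priorPreconditionedHessian V lam) :
    𝓑.B - 𝓑.posteriorCov
      = 𝓑.modes V * diagonal (fun i => lam i * (1 + lam i)⁻¹) * (𝓑.modes V)ᵀ := by
  have hd : diagonal (fun i => lam i * (1 + lam i)⁻¹)
      = 1 - diagonal (fun i => (1 + lam i)⁻¹) := by
    rw [← diagonal_one, diagonal_sub]
    congr 1; ext i
    have := eigenvalue_nonneg hB hR hV i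
    field_simp; ring
  rw [hd, Matrix.mul_sub, Matrix.sub_mul, Matrix.mul_one, modes_mul_transpose hB hV.orthonormal,
    posteriorCov_eq hB hR hV]

/-! ### The gain and the innovation covariance -/

theorem innovationCov_posDef (hB : 𝓑.B.PosDef) (hR : 𝓑.R.PosDef) : 𝓑.innovationCov.PosDef := by
  have h := hB.posSemidef.mul_mul_conjTranspose_same 𝓑.H
  rw [conjTranspose_eq_transpose_of_trivial] at h
  exact PosDef.posSemidef_add h hR

theorem gain_mul_innovationCov (hB : 𝓑.B.PosDef) (hR : 𝓑.R.PosDef) :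
    𝓑.gain * 𝓑.innovationCov = 𝓑.B * 𝓑.Hᵀ := by
  rw [gain, Matrix.mul_assoc, nonsing_inv_mul _
    ((isUnit_iff_isUnit_det _).1 (innovationCov_posDef hB hR).isUnit), Matrix.mul_one]

theorem transpose_eq_of_posDef {m : ℕ} {S : Matrix (Fin m) (Fin m) ℝ} (hS : S.PosDef) :
    Sᵀ = S := by
  simpa [conjTranspose_eq_transpose_of_trivial] using hS.isHermitian.eq

/-- The gain in information form, `K = Pᵃ Hᵀ R⁻¹`. -/
theorem posteriorCov_mul_eq_gain (hB : 𝓑.B.PosDef) (hR : 𝓑.R.PosDef)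
    (hV : IsEigendecomposition 𝓑.priorPreconditionedHessian V lam) :
    𝓑.posteriorCov * 𝓑.Hᵀ * 𝓑.R⁻¹ = 𝓑.gain := by
  have hYu := (isUnit_iff_isUnit_det _).1 (innovationCov_posDef hB hR).isUnit
  have hBu := (isUnit_iff_isUnit_det _).1 hB.isUnit
  have hRu := (isUnit_iff_isUnit_det _).1 hR.isUnit
  have hPA := mul_eq_one_comm.1 (precision_mul_posteriorCov hB hR hV)
  have key : (𝓑.B⁻¹ + 𝓑.Hᵀ * 𝓑.R⁻¹ * 𝓑.H) * (𝓑.B * 𝓑.Hᵀ)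
      = 𝓑.Hᵀ * 𝓑.R⁻¹ * 𝓑.innovationCov := by
    rw [innovationCov, Matrix.add_mul, ← Matrix.mul_assoc 𝓑.B⁻¹, nonsing_inv_mul _ hBu,
      Matrix.one_mul, Matrix.mul_add, Matrix.mul_assoc 𝓑.Hᵀ 𝓑.R⁻¹ 𝓑.R, nonsing_inv_mul _ hRu,
      Matrix.mul_one, add_comm]
    simp only [Matrix.mul_assoc]
  have h2 : 𝓑.B * 𝓑.Hᵀ = 𝓑.posteriorCov * (𝓑.Hᵀ * 𝓑.R⁻¹ * 𝓑.innovationCov) := by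
    rw [← key, ← Matrix.mul_assoc, hPA, Matrix.one_mul]
  rw [gain, h2, Matrix.mul_assoc, Matrix.mul_assoc, Matrix.mul_assoc _ 𝓑.innovationCov,
    mul_nonsing_inv _ hYu, Matrix.mul_one]

/-- The covariance of the posterior mean `K d` is `Q_var = B - Pᵃ`. -/
theorem gain_mul_innovationCov_mul_transpose (hB : 𝓑.B.PosDef) (hR : 𝓑.R.PosDef)
    (hV : IsEigendecomposition 𝓑.priorPreconditionedHessian V lam) :
    𝓑.gain * 𝓑.innovationCov * 𝓑.gainᵀ = 𝓑.B - 𝓑.posteriorCov := by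
  have hBu := (isUnit_iff_isUnit_det _).1 hB.isUnit
  have hPA := mul_eq_one_comm.1 (precision_mul_posteriorCov hB hR hV)
  have hYt := transpose_eq_of_posDef (innovationCov_posDef hB hR)
  have h1 : 𝓑.innovationCov * 𝓑.gainᵀ = 𝓑.H * 𝓑.B := by
    have := congrArg transpose (gain_mul_innovationCov hB hR)
    simpa [transpose_mul, hYt, transpose_eq_of_posDef hB] using this
  have h2 : 𝓑.Hᵀ * 𝓑.R⁻¹ * (𝓑.H * 𝓑.B)
      = (𝓑.B⁻¹ + 𝓑.Hᵀ * 𝓑.R⁻¹ * 𝓑.H) * 𝓑.B - 1 := by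
    rw [Matrix.add_mul, nonsing_inv_mul _ hBu, add_sub_cancel_left, Matrix.mul_assoc _ 𝓑.H]
  rw [Matrix.mul_assoc, h1, ← posteriorCov_mul_eq_gain hB hR hV, Matrix.mul_assoc _ 𝓑.Hᵀ,
    Matrix.mul_assoc 𝓑.posteriorCov, h2, Matrix.mul_sub, ← Matrix.mul_assoc, hPA, Matrix.one_mul,
    Matrix.mul_one]

/-- The covariance of `Hᵀ R⁻¹ d` in the modes. -/
theorem information_innovationCov_eq (hB : 𝓑.B.PosDef) (hR : 𝓑.R.PosDef)
    (hV : IsEigendecomposition 𝓑.priorPreconditionedHessian V lam) :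
    (𝓑.Hᵀ * 𝓑.R⁻¹) * 𝓑.innovationCov * (𝓑.Hᵀ * 𝓑.R⁻¹)ᵀ
      = (𝓑.modeCoords V)ᵀ * diagonal (fun i => lam i ^ 2 + lam i) * 𝓑.modeCoords V := by
  have hRu := (isUnit_iff_isUnit_det _).1 hR.isUnit
  have hE := modeCoords_mul_modes hB hV.orthonormal
  have hEt := modes_transpose_mul hB hV.orthonormal
  have h1 : (𝓑.Hᵀ * 𝓑.R⁻¹) * 𝓑.innovationCov * (𝓑.Hᵀ * 𝓑.R⁻¹)ᵀ
      = (𝓑.Hᵀ * 𝓑.R⁻¹ * 𝓑.H) * 𝓑.B * (𝓑.Hᵀ * 𝓑.R⁻¹ * 𝓑.H) + 𝓑.Hᵀ * 𝓑.R⁻¹ * 𝓑.H := by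
    rw [transpose_mul, transpose_transpose, transpose_eq_of_posDef hR.inv, innovationCov,
      Matrix.mul_add, Matrix.mul_assoc 𝓑.Hᵀ 𝓑.R⁻¹ 𝓑.R, nonsing_inv_mul _ hRu, Matrix.mul_one,
      Matrix.add_mul]
    simp only [Matrix.mul_assoc]
  rw [h1, information_eq hB hV]
  have h2 : (𝓑.modeCoords V)ᵀ * diagonal lam * 𝓑.modeCoords V * 𝓑.B *
        ((𝓑.modeCoords V)ᵀ * diagonal lam * 𝓑.modeCoords V)
      = (𝓑.modeCoords V)ᵀ * (diagonal lam * diagonal lam) * 𝓑.modeCoords V := by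
    conv_lhs => rw [← modes_mul_transpose hB hV.orthonormal]
    calc _ = (𝓑.modeCoords V)ᵀ * diagonal lam * (𝓑.modeCoords V * 𝓑.modes V) *
          ((𝓑.modes V)ᵀ * (𝓑.modeCoords V)ᵀ) * diagonal lam * 𝓑.modeCoords V := by
          simp only [Matrix.mul_assoc]
      _ = _ := by rw [hE, hEt]; simp only [Matrix.mul_assoc, Matrix.mul_one]
  rw [h2, ← Matrix.add_mul, ← Matrix.mul_add, diagonal_mul_diagonal, diagonal_add]
  simp only [sq]

/-! ### Weighted norms diagonalised by the modes -/

variable (𝓑) in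
/-- A square root of the weight matrix that has eigenvalues `w` in the coordinates of the modes:
`w = 1` gives `B⁻¹`, and `w = 1 + lam` gives `(Pᵃ)⁻¹`. -/
noncomputable def weightRoot (V : Matrix (Fin n) (Fin n) ℝ) (w : Fin n → ℝ) :
    Matrix (Fin n) (Fin n) ℝ :=
  diagonal (fun i => Real.sqrt (w i)) * 𝓑.modeCoords V

theorem weightRoot_transpose_mul {w : Fin n → ℝ} (hw : ∀ i, 0 ≤ w i) :
    (𝓑.weightRoot V w)ᵀ * 𝓑.weightRoot V w
      = (𝓑.modeCoords V)ᵀ * diagonal w * 𝓑.modeCoords V := by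
  have : diagonal (fun i => Real.sqrt (w i)) * diagonal (fun i => Real.sqrt (w i))
      = diagonal w := by
    rw [diagonal_mul_diagonal]; congr 1; ext i; exact Real.mul_self_sqrt (hw i)
  rw [weightRoot, transpose_mul, diagonal_transpose, ← this]
  simp only [Matrix.mul_assoc]

/-- In the modes the weighted covariance `S (E D Eᵀ) Sᵀ` of a diagonal `D` is again diagonal. -/
theorem weightRoot_congr_modes (hB : 𝓑.B.PosDef) (hV : Vᵀ * V = 1) {w : Fin n → ℝ}
    (hw : ∀ i, 0 ≤ w i) (c : Fin n → ℝ) :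
    𝓑.weightRoot V w * (𝓑.modes V * diagonal c * (𝓑.modes V)ᵀ) * (𝓑.weightRoot V w)ᵀ
      = diagonal fun i => w i * c i := by
  rw [weightRoot, transpose_mul, diagonal_transpose]
  calc _ = diagonal (fun i => Real.sqrt (w i)) * (𝓑.modeCoords V * 𝓑.modes V) * diagonal c *
        ((𝓑.modes V)ᵀ * (𝓑.modeCoords V)ᵀ) * diagonal (fun i => Real.sqrt (w i)) := by
        simp only [Matrix.mul_assoc]
    _ = _ := by
      rw [modeCoords_mul_modes hB hV, modes_transpose_mul hB hV, Matrix.mul_one, Matrix.mul_one,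
        diagonal_mul_diagonal, diagonal_mul_diagonal]
      congr 1; ext i
      rw [mul_right_comm, Real.mul_self_sqrt (hw i)]

/-- Truncating a diagonal form in the modes truncates the rows of its weighted image. -/
theorem weightRoot_mul_modes (hB : 𝓑.B.PosDef) (hV : Vᵀ * V = 1) (w c : Fin n → ℝ) {l : ℕ}
    (X : Matrix (Fin n) (Fin l) ℝ) (k : ℕ) :
    𝓑.weightRoot V w * (𝓑.modes V * (coordProj n k * diagonal c) * X)
      = coordProj n k * (𝓑.weightRoot V w * (𝓑.modes V * diagonal c * X)) := by
  have hcomm : diagonal (fun i => Real.sqrt (w i)) * coordProj n k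
      = coordProj n k * diagonal (fun i => Real.sqrt (w i)) := by
    rw [coordProj, diagonal_mul_diagonal, diagonal_mul_diagonal]; simp only [mul_comm]
  have hX : ∀ D : Matrix (Fin n) (Fin n) ℝ, 𝓑.weightRoot V w * (𝓑.modes V * D * X)
      = diagonal (fun i => Real.sqrt (w i)) * (D * X) := fun D => by
    calc _ = diagonal (fun i => Real.sqrt (w i)) * (𝓑.modeCoords V * 𝓑.modes V) * (D * X) := by
          rw [weightRoot]; simp only [Matrix.mul_assoc]
      _ = _ := by rw [modeCoords_mul_modes hB hV, Matrix.mul_one]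
  rw [hX, hX, Matrix.mul_assoc (coordProj n k), ← Matrix.mul_assoc, hcomm, Matrix.mul_assoc]

/-! ### The approximations -/

theorem dofProjector_eq (V : Matrix (Fin n) (Fin n) ℝ) (k : ℕ) :
    𝓑.dofProjector V k = 𝓑.modes V * coordProj n k * 𝓑.modeCoords V := by
  have h := sum_smul_vecMulVec_col (k := k) V (fun _ => 1)
  simp only [one_smul, diagonal_one, Matrix.mul_one] at h
  rw [dofProjector, h, modes, modeCoords]
  simp only [Matrix.mul_assoc]

theorem coordProj_mul_self (m k : ℕ) : coordProj m k * coordProj m k = coordProj m k := by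
  rw [coordProj, diagonal_mul_diagonal]; congr 1; ext i; split_ifs <;> simp

theorem dofProjector_mul_prior (hB : 𝓑.B.PosDef) (hV : Vᵀ * V = 1) (k : ℕ) :
    𝓑.dofProjector V k * 𝓑.B = 𝓑.modes V * coordProj n k * (𝓑.modes V)ᵀ := by
  conv_lhs => rw [← modes_mul_transpose hB hV]
  rw [dofProjector_eq, Matrix.mul_assoc, ← Matrix.mul_assoc (𝓑.modeCoords V),
    modeCoords_mul_modes hB hV, Matrix.one_mul]

theorem dofProjector_mul_self (hB : 𝓑.B.PosDef) (hV : Vᵀ * V = 1) (k : ℕ) :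
    𝓑.dofProjector V k * 𝓑.dofProjector V k = 𝓑.dofProjector V k := by
  rw [dofProjector_eq]
  calc _ = 𝓑.modes V * (coordProj n k * (𝓑.modeCoords V * 𝓑.modes V) * coordProj n k) *
        𝓑.modeCoords V := by simp only [Matrix.mul_assoc]
    _ = _ := by rw [modeCoords_mul_modes hB hV, Matrix.mul_one, coordProj_mul_self]

/-- A projector that is self-adjoint for the inner product of `B⁻¹` leaves the innovation
covariance unchanged, because the representativeness error makes up for the lost prior variance;
so the projected gain is the projection of the gain. -/
theorem gain_projected_dofProjector (hB : 𝓑.B.PosDef) (hV : Vᵀ * V = 1) (k : ℕ) :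
    (𝓑.projected (𝓑.dofProjector V k)).gain = 𝓑.dofProjector V k * 𝓑.gain := by
  set Q := 𝓑.dofProjector V k with hQ
  have hsym : 𝓑.B * Qᵀ = Q * 𝓑.B := by
    have h := dofProjector_mul_prior hB hV k
    have ht := congrArg transpose h
    have hc : (coordProj n k)ᵀ = coordProj n k := diagonal_transpose _
    rw [transpose_mul, transpose_mul, transpose_mul, transpose_transpose, hc,
      transpose_eq_of_posDef hB, ← Matrix.mul_assoc] at ht
    rw [ht, h]
  have hQQ : Q * Q = Q := dofProjector_mul_self hB hV k
  have hQBQ : Q * 𝓑.B * Qᵀ = Q * 𝓑.B := by rw [Matrix.mul_assoc, hsym, ← Matrix.mul_assoc, hQQ]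
  have hcov : (𝓑.projected Q).innovationCov = 𝓑.innovationCov := by
    simp only [innovationCov, projected]
    rw [hQBQ, hsym, transpose_mul]
    have : 𝓑.H * Q * (Q * 𝓑.B) * (Qᵀ * 𝓑.Hᵀ) = 𝓑.H * (Q * 𝓑.B) * 𝓑.Hᵀ := by
      calc _ = 𝓑.H * ((Q * Q) * 𝓑.B * Qᵀ) * 𝓑.Hᵀ := by simp only [Matrix.mul_assoc]
        _ = _ := by rw [hQQ, hQBQ]
    rw [this]
    simp only [Matrix.mul_add, Matrix.mul_sub, Matrix.add_mul, Matrix.sub_mul]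
    abel
  rw [gain, hcov, gain]
  simp only [projected]
  rw [hQBQ, transpose_mul, ← Matrix.mul_assoc (Q * 𝓑.B), hQBQ]
  simp only [Matrix.mul_assoc]

theorem dofProjector_mul (V : Matrix (Fin n) (Fin n) ℝ) (k : ℕ) {l : ℕ}
    (X : Matrix (Fin n) (Fin l) ℝ) : 𝓑.dofProjector V k * X
      = 𝓑.modes V * (coordProj n k * diagonal fun _ => 1) * (𝓑.modeCoords V * X) := by
  rw [dofProjector_eq, diagonal_one, Matrix.mul_one]; simp only [Matrix.mul_assoc]

theorem rank_projected_gain_le (hB : 𝓑.B.PosDef) (hV : Vᵀ * V = 1) (k : ℕ) :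
    (𝓑.projected (𝓑.dofProjector V k)).gain.rank ≤ k := by
  rw [gain_projected_dofProjector hB hV, dofProjector_eq]
  exact (rank_mul_le_left _ _).trans <| (rank_mul_le_left _ _).trans <|
    (rank_mul_le_right _ _).trans (rank_coordProj_le n k)

theorem dofCov_eq (V : Matrix (Fin n) (Fin n) ℝ) (lam : Fin n → ℝ) (k : ℕ) :
    𝓑.B - 𝓑.dofCov V lam k = 𝓑.modes V *
      (coordProj n k * diagonal fun i => lam i * (1 + lam i)⁻¹) * (𝓑.modes V)ᵀ := by
  rw [dofCov, sub_sub_cancel, sum_smul_vecMulVec_col, modes, transpose_mul, matSqrt_transpose]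
  simp only [Matrix.mul_assoc]

theorem dofCov_mem_lowRankUpdate (hB : 𝓑.B.PosDef) (hR : 𝓑.R.PosDef)
    (hV : IsEigendecomposition 𝓑.priorPreconditionedHessian V lam) (k : ℕ) :
    𝓑.dofCov V lam k ∈ lowRankUpdate 𝓑.B k := by
  have hl := eigenvalue_nonneg hB hR hV
  set e : Matrix (Fin n) (Fin n) ℝ := diagonal fun i => Real.sqrt (lam i * (1 + lam i)⁻¹)
  have he : (coordProj n k * e) * (coordProj n k * e)ᵀ
      = coordProj n k * diagonal fun i => lam i * (1 + lam i)⁻¹ := by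
    simp only [coordProj, e, diagonal_mul_diagonal, diagonal_transpose]
    congr 1; ext i
    have h0 : 0 ≤ lam i * (1 + lam i)⁻¹ := by have := hl i; positivity
    split_ifs
    · rw [one_mul, one_mul, Real.mul_self_sqrt h0]
    · simp
  have hB' : 𝓑.dofCov V lam k = 𝓑.modes V * diagonal (fun i : Fin n =>
      1 - (if i.val < k then 1 else 0) * (lam i * (1 + lam i)⁻¹)) * (𝓑.modes V)ᵀ := by
    rw [← sub_sub_cancel 𝓑.B (𝓑.dofCov V lam k), dofCov_eq]
    conv_lhs => rw [← modes_mul_transpose hB hV.orthonormal]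
    have hd : diagonal (fun i : Fin n =>
        1 - (if i.val < k then 1 else 0) * (lam i * (1 + lam i)⁻¹))
          = 1 - coordProj n k * diagonal fun i => lam i * (1 + lam i)⁻¹ := by
      rw [coordProj, diagonal_mul_diagonal, ← diagonal_one, diagonal_sub]
    rw [hd, Matrix.mul_sub, Matrix.sub_mul, Matrix.mul_one]
  refine ⟨𝓑.modes V * (coordProj n k * e), (rank_mul_le_right _ _).trans
    ((rank_mul_le_left _ _).trans (rank_coordProj_le n k)), ?_, ?_⟩
  · rw [transpose_mul, Matrix.mul_assoc (𝓑.modes V), ← Matrix.mul_assoc _ _ (𝓑.modes V)ᵀ, he,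
      ← Matrix.mul_assoc, ← dofCov_eq, sub_sub_cancel]
  · rw [hB', ← conjTranspose_eq_transpose_of_trivial]
    refine (PosSemidef.diagonal fun i => ?_).mul_mul_conjTranspose_same _
    have h1 : lam i * (1 + lam i)⁻¹ ≤ 1 := by
      have := hl i
      rw [← div_eq_mul_inv, div_le_one (by positivity)]; linarith
    simp only [Pi.zero_apply]
    split_ifs <;> linarith

variable {U : Matrix (Fin n) (Fin n) ℝ} {δ : Fin n → ℝ}

theorem transpose_mul_varMatrix_mul (hU : IsEigendecomposition 𝓑.varMatrix U δ) :
    Uᵀ * 𝓑.varMatrix * U = diagonal δ := by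
  rw [Matrix.mul_assoc, hU.eigen, ← Matrix.mul_assoc, hU.orthonormal, Matrix.one_mul]

/-- The truncated singular value decomposition of `B Hᵀ Y^{-1/2}` is the orthogonal projection of
the gain on the leading left singular vectors; where `δ i` vanishes, so does the row `u_iᵀ K`. -/
theorem varGain_eq (hB : 𝓑.B.PosDef) (hR : 𝓑.R.PosDef)
    (hV : IsEigendecomposition 𝓑.priorPreconditionedHessian V lam)
    (hU : IsEigendecomposition 𝓑.varMatrix U δ) (k : ℕ) :
    𝓑.varGain U δ k = U * coordProj n k * (Uᵀ * 𝓑.gain) := by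
  have hY := innovationCov_posDef hB hR
  set T := matSqrt 𝓑.innovationCov with hT
  have hTT : T * T = 𝓑.innovationCov := matSqrt_mul_self hY.posSemidef
  have hTu := isUnit_det_matSqrt hY
  have hTt : Tᵀ = T := matSqrt_transpose _
  have hBt := transpose_eq_of_posDef hB
  -- `L` is `Y^{-1/2} H B`, the transpose of the whitened gain
  set L := T⁻¹ * 𝓑.H * 𝓑.B with hL
  have hLt : Lᵀ = 𝓑.B * 𝓑.Hᵀ * T⁻¹ := by
    rw [hL, transpose_mul, transpose_mul, transpose_nonsing_inv, hTt, hBt, Matrix.mul_assoc]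
  have hgain : Lᵀ * T⁻¹ = 𝓑.gain := by
    rw [hLt, gain, ← hTT, Matrix.mul_inv_rev, Matrix.mul_assoc]
  have hGT : 𝓑.gain * T = Lᵀ := by
    rw [← hgain, Matrix.mul_assoc, nonsing_inv_mul _ hTu, Matrix.mul_one]
  have hLL : Lᵀ * L = 𝓑.varMatrix := by
    rw [varMatrix, ← gain_mul_innovationCov_mul_transpose hB hR hV, ← hTT]
    calc Lᵀ * L = (𝓑.gain * T) * (𝓑.gain * T)ᵀ := by rw [hGT, transpose_transpose]
      _ = _ := by rw [transpose_mul, hTt]; simp only [Matrix.mul_assoc]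
  have hLU : (L * U)ᵀ * (L * U) = diagonal δ := by
    rw [← transpose_mul_varMatrix_mul hU, ← hLL, transpose_mul]; simp only [Matrix.mul_assoc]
  have hz : ∀ i, Real.sqrt (δ i) • 𝓑.rightSingularVector U δ i = (L * U).col i := fun i => by
    have hδ : δ i = ∑ a, (L * U) a i ^ 2 := by
      have h := congrFun (congrFun hLU i) i
      rw [diagonal_apply_eq, mul_apply] at h
      rw [← h]
      exact Finset.sum_congr rfl fun a _ => (sq _).symm
    have hδ0 : 0 ≤ δ i := by rw [hδ]; exact Finset.sum_nonneg fun a _ => sq_nonneg _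
    rw [rightSingularVector, smul_smul]
    have hcol : (L *ᵥ U.col i) = (L * U).col i := rfl
    rw [← hL, hcol]
    rcases hδ0.eq_or_lt with h0 | hpos
    · have hzero : (L * U).col i = 0 := by
        ext a
        rw [hδ, eq_comm, Finset.sum_eq_zero_iff_of_nonneg fun a _ => sq_nonneg _] at h0
        exact pow_eq_zero_iff two_ne_zero |>.1 (h0 a (Finset.mem_univ a))
      rw [hzero, smul_zero]
    · rw [mul_inv_cancel₀ (Real.sqrt_pos.2 hpos).ne', one_smul]
  have hsum : ∑ i : Fin n with i.val < k, Real.sqrt (δ i) •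
      vecMulVec (U.col i) (𝓑.rightSingularVector U δ i) = U * coordProj n k * (L * U)ᵀ := by
    simp only [← vecMulVec_smul, hz]
    ext a b
    rw [coordProj, mul_apply, Matrix.sum_apply, Finset.sum_filter]
    simp only [mul_diagonal, vecMulVec_apply, col_apply, transpose_apply]
    exact Finset.sum_congr rfl fun i _ => by split_ifs <;> simp
  rw [varGain, hsum, ← hT, transpose_mul, ← hgain]
  simp only [Matrix.mul_assoc]

theorem rank_varGain_le (hB : 𝓑.B.PosDef) (hR : 𝓑.R.PosDef)
    (hV : IsEigendecomposition 𝓑.priorPreconditionedHessian V lam)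
    (hU : IsEigendecomposition 𝓑.varMatrix U δ) (k : ℕ) : (𝓑.varGain U δ k).rank ≤ k := by
  rw [varGain_eq hB hR hV hU]
  exact (rank_mul_le_left _ _).trans <| (rank_mul_le_right _ _).trans (rank_coordProj_le n k)

end BayesianProblem

namespace BayesianProblem

/-! ### Optimality of the approximations -/

section Optimality

variable {n p : ℕ} {𝓑 : BayesianProblem n p} {V U : Matrix (Fin n) (Fin n) ℝ}
  {lam δ : Fin n → ℝ} {Ω : Type*} [MeasurableSpace Ω] {P : Measure Ω}
  {d : Ω → EuclideanSpace ℝ (Fin p)}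

/-- Expected weighted errors are quadratic trace functionals, so the low-rank approximation
theorem `isLeast_trace_of_truncation` applies to them. -/
theorem isLeast_expected_error {k : ℕ} {ι : Type*} (hY : 𝓑.innovationCov.PosSemidef)
    (hE : ∀ M : Matrix (Fin n) (Fin p) ℝ,
      ∫ ω, ‖act M (d ω)‖ ^ 2 ∂P = (M * 𝓑.innovationCov * Mᵀ).trace)
    {W S : Matrix (Fin n) (Fin n) ℝ} (hW : W = Sᵀ * S) {C : Matrix (Fin n) (Fin p) ℝ}
    {μ : Fin n → ℝ} (hC : S * C * 𝓑.innovationCov * (S * C)ᵀ = diagonal μ) (hμ : Antitone μ)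
    (N : ι → Matrix (Fin n) (Fin p) ℝ) {𝓒 : Set ι} (hN : ∀ j ∈ 𝓒, (N j).rank ≤ k)
    {j₀ : ι} (hj₀ : j₀ ∈ 𝓒) (hopt : S * N j₀ = coordProj n k * (S * C)) :
    IsLeast ((fun j => ∫ ω, weightedNorm W (act (N j - C) (d ω)) ^ 2 ∂P) '' 𝓒)
        (∫ ω, weightedNorm W (act (N j₀ - C) (d ω)) ^ 2 ∂P) ∧
      ∫ ω, weightedNorm W (act (N j₀ - C) (d ω)) ^ 2 ∂P = ∑ i : Fin n with k ≤ i.val, μ i := by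
  simp_rw [weightedNorm_sq_act hW, hE]
  exact isLeast_trace_of_truncation hY hC hμ N hN hj₀ hopt

/-- In the eigenbasis `U` of `Q_var` the Euclidean norm has the root `Uᵀ`, and `Uᵀ K` has the
diagonal covariance `δ`. -/
theorem isLeast_varGain (hB : 𝓑.B.PosDef) (hR : 𝓑.R.PosDef)
    (hV : IsEigendecomposition 𝓑.priorPreconditionedHessian V lam)
    (hU : IsEigendecomposition 𝓑.varMatrix U δ)
    (hE : ∀ M : Matrix (Fin n) (Fin p) ℝ,
      ∫ ω, ‖act M (d ω)‖ ^ 2 ∂P = (M * 𝓑.innovationCov * Mᵀ).trace) (k : ℕ) :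
    IsLeast ((fun K => ∫ ω, ‖act (K - 𝓑.gain) (d ω)‖ ^ 2 ∂P) '' lowRank n p k)
        (∫ ω, ‖act (𝓑.varGain U δ k - 𝓑.gain) (d ω)‖ ^ 2 ∂P) ∧
      ∫ ω, ‖act (𝓑.varGain U δ k - 𝓑.gain) (d ω)‖ ^ 2 ∂P
        = ∑ i : Fin n with k ≤ i.val, δ i := by
  have hW : (1 : Matrix (Fin n) (Fin n) ℝ) = (Uᵀ)ᵀ * Uᵀ := by
    rw [transpose_transpose, mul_eq_one_comm.1 hU.orthonormal]
  have hC : Uᵀ * 𝓑.gain * 𝓑.innovationCov * (Uᵀ * 𝓑.gain)ᵀ = diagonal δ := by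
    rw [← transpose_mul_varMatrix_mul hU, varMatrix,
      ← gain_mul_innovationCov_mul_transpose hB hR hV, transpose_mul, transpose_transpose]
    simp only [Matrix.mul_assoc]
  have hopt : Uᵀ * 𝓑.varGain U δ k = coordProj n k * (Uᵀ * 𝓑.gain) := by
    rw [varGain_eq hB hR hV hU, Matrix.mul_assoc U, ← Matrix.mul_assoc Uᵀ U, hU.orthonormal,
      Matrix.one_mul]
  have h := isLeast_expected_error (innovationCov_posDef hB hR).posSemidef hE hW hC hU.descending
    (fun K => K) (𝓒 := lowRank n p k) (fun K hK => hK) (rank_varGain_le hB hR hV hU k) hopt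
  have h1 : (1 : Matrix (Fin n) (Fin n) ℝ) = 1ᵀ * 1 := by simp
  simpa only [weightedNorm_sq_act h1, Matrix.one_mul] using h

/-- One argument serves both weights: `w = 1` gives `B⁻¹`, and `w = 1 + lam` gives `(Pᵃ)⁻¹`. -/
theorem isLeast_projected_gain (hB : 𝓑.B.PosDef) (hR : 𝓑.R.PosDef)
    (hV : IsEigendecomposition 𝓑.priorPreconditionedHessian V lam)
    {w : Fin n → ℝ} (hw : ∀ i, 0 ≤ w i) {W : Matrix (Fin n) (Fin n) ℝ}
    (hW : W = (𝓑.weightRoot V w)ᵀ * 𝓑.weightRoot V w)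
    (hE : ∀ M : Matrix (Fin n) (Fin p) ℝ,
      ∫ ω, ‖act M (d ω)‖ ^ 2 ∂P = (M * 𝓑.innovationCov * Mᵀ).trace)
    {μ : Fin n → ℝ} (hμ : Antitone μ) (hμw : ∀ i, w i * (lam i * (1 + lam i)⁻¹) = μ i) (k : ℕ) :
    IsLeast ((fun K => ∫ ω, weightedNorm W (act (K - 𝓑.gain) (d ω)) ^ 2 ∂P) '' lowRank n p k)
        (∫ ω, weightedNorm W
          (act ((𝓑.projected (𝓑.dofProjector V k)).gain - 𝓑.gain) (d ω)) ^ 2 ∂P) ∧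
      ∫ ω, weightedNorm W
          (act ((𝓑.projected (𝓑.dofProjector V k)).gain - 𝓑.gain) (d ω)) ^ 2 ∂P
        = ∑ i : Fin n with k ≤ i.val, μ i := by
  have ho := hV.orthonormal
  have hC : 𝓑.weightRoot V w * 𝓑.gain * 𝓑.innovationCov * (𝓑.weightRoot V w * 𝓑.gain)ᵀ
      = diagonal μ := by
    rw [← funext hμw, ← weightRoot_congr_modes hB ho hw, ← prior_sub_posteriorCov_eq hB hR hV,
      ← gain_mul_innovationCov_mul_transpose hB hR hV, transpose_mul]
    simp only [Matrix.mul_assoc]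
  have hopt : 𝓑.weightRoot V w * (𝓑.projected (𝓑.dofProjector V k)).gain
      = coordProj n k * (𝓑.weightRoot V w * 𝓑.gain) := by
    rw [gain_projected_dofProjector hB ho, dofProjector_mul, weightRoot_mul_modes hB ho,
      diagonal_one, Matrix.mul_one, ← Matrix.mul_assoc (𝓑.modes V), modes_mul_modeCoords hB ho,
      Matrix.one_mul]
  exact isLeast_expected_error (innovationCov_posDef hB hR).posSemidef hE hW hC hμ
    (fun K => K) (𝓒 := lowRank n p k) (fun K hK => hK) (rank_projected_gain_le hB ho k) hopt

/-- Here the role of the low-rank matrix is played by `(P̃ - B) Hᵀ R⁻¹` and that of its target by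
`(Pᵃ - B) Hᵀ R⁻¹`. -/
theorem isLeast_dofCov (hB : 𝓑.B.PosDef) (hR : 𝓑.R.PosDef)
    (hV : IsEigendecomposition 𝓑.priorPreconditionedHessian V lam)
    {w : Fin n → ℝ} (hw : ∀ i, 0 ≤ w i) {W : Matrix (Fin n) (Fin n) ℝ}
    (hW : W = (𝓑.weightRoot V w)ᵀ * 𝓑.weightRoot V w)
    (hE : ∀ M : Matrix (Fin n) (Fin p) ℝ,
      ∫ ω, ‖act M (d ω)‖ ^ 2 ∂P = (M * 𝓑.innovationCov * Mᵀ).trace)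
    {μ : Fin n → ℝ} (hμ : Antitone μ)
    (hμw : ∀ i, w i * ((lam i * (1 + lam i)⁻¹) ^ 2 * (lam i ^ 2 + lam i)) = μ i) (k : ℕ) :
    IsLeast ((fun Pt => ∫ ω, weightedNorm W
          (act ((Pt - 𝓑.posteriorCov) * 𝓑.Hᵀ * 𝓑.R⁻¹) (d ω)) ^ 2 ∂P) '' lowRankUpdate 𝓑.B k)
        (∫ ω, weightedNorm W
          (act ((𝓑.dofCov V lam k - 𝓑.posteriorCov) * 𝓑.Hᵀ * 𝓑.R⁻¹) (d ω)) ^ 2 ∂P) ∧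
      ∫ ω, weightedNorm W
          (act ((𝓑.dofCov V lam k - 𝓑.posteriorCov) * 𝓑.Hᵀ * 𝓑.R⁻¹) (d ω)) ^ 2 ∂P
        = ∑ i : Fin n with k ≤ i.val, μ i := by
  have ho := hV.orthonormal
  set S := 𝓑.weightRoot V w
  set c : Fin n → ℝ := fun i => lam i * (1 + lam i)⁻¹
  set X := 𝓑.Hᵀ * 𝓑.R⁻¹ with hX
  have hPa : 𝓑.posteriorCov - 𝓑.B = -(𝓑.modes V * diagonal c * (𝓑.modes V)ᵀ) := by
    rw [← prior_sub_posteriorCov_eq hB hR hV, neg_sub]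
  have hPt : 𝓑.dofCov V lam k - 𝓑.B
      = -(𝓑.modes V * (coordProj n k * diagonal c) * (𝓑.modes V)ᵀ) := by
    rw [← dofCov_eq, neg_sub]
  have hC : S * ((𝓑.posteriorCov - 𝓑.B) * X) * 𝓑.innovationCov *
      (S * ((𝓑.posteriorCov - 𝓑.B) * X))ᵀ = diagonal μ := by
    have hcc : diagonal c * diagonal (fun i => lam i ^ 2 + lam i) * diagonal c
        = diagonal fun i => c i ^ 2 * (lam i ^ 2 + lam i) := by
      rw [diagonal_mul_diagonal, diagonal_mul_diagonal]; congr 1; ext i; ring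
    have hct : (diagonal c)ᵀ = diagonal c := diagonal_transpose c
    rw [← funext hμw, ← weightRoot_congr_modes hB ho hw, ← hcc, hPa]
    calc _ = S * (𝓑.modes V * diagonal c * (𝓑.modes V)ᵀ * (X * 𝓑.innovationCov * Xᵀ) *
          (𝓑.modes V * diagonal c * (𝓑.modes V)ᵀ)) * Sᵀ := by
          simp only [transpose_mul, transpose_neg, transpose_transpose, hct, Matrix.neg_mul,
            Matrix.mul_neg, neg_neg, Matrix.mul_assoc]
      _ = S * (𝓑.modes V * diagonal c * ((𝓑.modes V)ᵀ * (𝓑.modeCoords V)ᵀ) *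
          diagonal (fun i => lam i ^ 2 + lam i) * (𝓑.modeCoords V * 𝓑.modes V) * diagonal c *
          (𝓑.modes V)ᵀ) * Sᵀ := by
          rw [hX, information_innovationCov_eq hB hR hV]; simp only [Matrix.mul_assoc]
      _ = _ := by
          rw [modes_transpose_mul hB ho, modeCoords_mul_modes hB ho]
          simp only [Matrix.mul_assoc, Matrix.mul_one, S]
  have hN : ∀ Pt ∈ lowRankUpdate 𝓑.B k, ((Pt - 𝓑.B) * X).rank ≤ k := by
    rintro _ ⟨Q, hQ, rfl, -⟩
    have : 𝓑.B - Q * Qᵀ - 𝓑.B = Q * -Qᵀ := by rw [Matrix.mul_neg]; abel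
    rw [this]
    exact (rank_mul_le_left _ _).trans <| (rank_mul_le_left _ _).trans hQ
  have hopt : S * ((𝓑.dofCov V lam k - 𝓑.B) * X)
      = coordProj n k * (S * ((𝓑.posteriorCov - 𝓑.B) * X)) := by
    rw [hPt, hPa, Matrix.neg_mul, Matrix.neg_mul, Matrix.mul_neg, Matrix.mul_neg, Matrix.mul_neg,
      Matrix.mul_assoc _ (𝓑.modes V)ᵀ, Matrix.mul_assoc _ (𝓑.modes V)ᵀ,
      weightRoot_mul_modes hB ho]
  have hdiff : ∀ Pt, (Pt - 𝓑.posteriorCov) * 𝓑.Hᵀ * 𝓑.R⁻¹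
      = (Pt - 𝓑.B) * X - (𝓑.posteriorCov - 𝓑.B) * X := fun Pt => by
    rw [← Matrix.sub_mul, sub_sub_sub_cancel_right, Matrix.mul_assoc]
  simp_rw [hdiff]
  exact isLeast_expected_error (innovationCov_posDef hB hR).posSemidef hE hW hC hμ
    (fun Pt => (Pt - 𝓑.B) * X) hN (dofCov_mem_lowRankUpdate hB hR hV k) hopt

end Optimality

theorem antitone_div_one_add {m : ℕ} {a : Fin m → ℝ} (ha : Antitone a) (h0 : ∀ i, 0 ≤ a i) :
    Antitone fun i => a i / (1 + a i) := fun i j hij => by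
  have h1 := h0 i
  have h2 := h0 j
  have h3 := ha hij
  dsimp only
  rw [div_le_div_iff₀ (by positivity) (by positivity)]
  linarith

theorem antitone_pow_three_div_one_add {m : ℕ} {a : Fin m → ℝ} (ha : Antitone a)
    (h0 : ∀ i, 0 ≤ a i) : Antitone fun i => a i ^ 3 / (1 + a i) := fun i j hij => by
  have h1 := mul_le_mul (pow_le_pow_left₀ (h0 j) (ha hij) 2) (antitone_div_one_add ha h0 hij)
    (by have := h0 j; positivity) (sq_nonneg _)
  simpa only [← mul_div_assoc, ← pow_succ] using h1

end BayesianProblem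

open BayesianProblem in
theorem mainTheorem4 {n p : ℕ} (k : ℕ) (𝓑 : BayesianProblem n p)
    (hB : 𝓑.B.PosDef) (hR : 𝓑.R.PosDef)
    -- eigenpairs `(v_i, lam_i)` of the prior-preconditioned Hessian
    (V : Matrix (Fin n) (Fin n) ℝ) (lam : Fin n → ℝ)
    (hV : IsEigendecomposition 𝓑.priorPreconditionedHessian V lam)
    -- eigenpairs `(u_i, δ_i)` of `Q_var`
    (U : Matrix (Fin n) (Fin n) ℝ) (δ : Fin n → ℝ)
    (hU : IsEigendecomposition 𝓑.varMatrix U δ)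
    -- the true (increment) state `x`, the observation error `ε` and the innovation `d = H x + ε`
    {Ω : Type*} [MeasurableSpace Ω] (P : Measure Ω) [IsProbabilityMeasure P]
    (x : Ω → EuclideanSpace ℝ (Fin n)) (ε d : Ω → EuclideanSpace ℝ (Fin p))
    (hxm : Measurable x) (hεm : Measurable ε)
    (hx : HasLaw x (multivariateGaussian 0 𝓑.B) P)
    (hε : HasLaw ε (multivariateGaussian 0 𝓑.R) P)
    (hind : IndepFun x ε P)
    (hd : ∀ ω, d ω = act 𝓑.H (x ω) + ε ω) :
    -- `xᵃ` is the mean of the posterior distribution of `x` given `d`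
    (fun ω => 𝓑.posteriorMean (d ω)) =ᵐ[P]
        P[x | MeasurableSpace.comap d inferInstance] ∧
    -- all the expectations below are those of integrable random variables
    (∀ M : Matrix (Fin n) (Fin p) ℝ,
      Integrable (fun ω => ‖act M (d ω)‖ ^ 2) P ∧
      Integrable (fun ω => weightedNorm 𝓑.B⁻¹ (act M (d ω)) ^ 2) P ∧
      Integrable (fun ω => weightedNorm 𝓑.posteriorCov⁻¹ (act M (d ω)) ^ 2) P) ∧
    -- the approximations belong to the classes over which they are optimal
    𝓑.varGain U δ k ∈ lowRank n p k ∧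
    (𝓑.projected (𝓑.dofProjector V k)).gain ∈ lowRank n p k ∧
    𝓑.dofCov V lam k ∈ lowRankUpdate 𝓑.B k ∧
    -- optimality of `xᵃ_var` for the Euclidean norm
    (IsLeast ((fun K => ∫ ω, ‖act (K - 𝓑.gain) (d ω)‖ ^ 2 ∂P) '' lowRank n p k)
        (∫ ω, ‖𝓑.xVar U δ k (d ω) - 𝓑.posteriorMean (d ω)‖ ^ 2 ∂P) ∧
      ∫ ω, ‖𝓑.xVar U δ k (d ω) - 𝓑.posteriorMean (d ω)‖ ^ 2 ∂P
        = ∑ i : Fin n with k ≤ i.val, δ i) ∧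
    -- optimality of `xᵃ_{Π_dof}` for the `B⁻¹`-weighted norm
    (IsLeast ((fun K => ∫ ω, weightedNorm 𝓑.B⁻¹ (act (K - 𝓑.gain) (d ω)) ^ 2 ∂P) ''
          lowRank n p k)
        (∫ ω, weightedNorm 𝓑.B⁻¹ (𝓑.xDof V k (d ω) - 𝓑.posteriorMean (d ω)) ^ 2 ∂P) ∧
      ∫ ω, weightedNorm 𝓑.B⁻¹ (𝓑.xDof V k (d ω) - 𝓑.posteriorMean (d ω)) ^ 2 ∂P
        = ∑ i : Fin n with k ≤ i.val, lam i / (1 + lam i)) ∧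
    -- optimality of `xᵃ_{Π_dof}` for the `(Pᵃ)⁻¹`-weighted norm
    (IsLeast ((fun K => ∫ ω, weightedNorm 𝓑.posteriorCov⁻¹ (act (K - 𝓑.gain) (d ω)) ^ 2 ∂P) ''
          lowRank n p k)
        (∫ ω, weightedNorm 𝓑.posteriorCov⁻¹
          (𝓑.xDof V k (d ω) - 𝓑.posteriorMean (d ω)) ^ 2 ∂P) ∧
      ∫ ω, weightedNorm 𝓑.posteriorCov⁻¹ (𝓑.xDof V k (d ω) - 𝓑.posteriorMean (d ω)) ^ 2 ∂P
        = ∑ i : Fin n with k ≤ i.val, lam i) ∧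
    -- optimality of `xᵃ_{FR_dof}` for the `B⁻¹`-weighted norm
    (IsLeast ((fun Pt => ∫ ω, weightedNorm 𝓑.B⁻¹
          (act ((Pt - 𝓑.posteriorCov) * 𝓑.Hᵀ * 𝓑.R⁻¹) (d ω)) ^ 2 ∂P) '' lowRankUpdate 𝓑.B k)
        (∫ ω, weightedNorm 𝓑.B⁻¹ (𝓑.xFRDof V lam k (d ω) - 𝓑.posteriorMean (d ω)) ^ 2 ∂P) ∧
      ∫ ω, weightedNorm 𝓑.B⁻¹ (𝓑.xFRDof V lam k (d ω) - 𝓑.posteriorMean (d ω)) ^ 2 ∂P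
        = ∑ i : Fin n with k ≤ i.val, lam i ^ 3 / (1 + lam i)) ∧
    -- optimality of `xᵃ_{FR_dof}` for the `(Pᵃ)⁻¹`-weighted norm
    (IsLeast ((fun Pt => ∫ ω, weightedNorm 𝓑.posteriorCov⁻¹
          (act ((Pt - 𝓑.posteriorCov) * 𝓑.Hᵀ * 𝓑.R⁻¹) (d ω)) ^ 2 ∂P) '' lowRankUpdate 𝓑.B k)
        (∫ ω, weightedNorm 𝓑.posteriorCov⁻¹
          (𝓑.xFRDof V lam k (d ω) - 𝓑.posteriorMean (d ω)) ^ 2 ∂P) ∧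
      ∫ ω, weightedNorm 𝓑.posteriorCov⁻¹
          (𝓑.xFRDof V lam k (d ω) - 𝓑.posteriorMean (d ω)) ^ 2 ∂P
        = ∑ i : Fin n with k ≤ i.val, lam i ^ 3) := by
  have hBs := hB.posSemidef
  have hRs := hR.posSemidef
  have ho := hV.orthonormal
  have hl := eigenvalue_nonneg hB hR hV
  have hl1 : ∀ i, 0 ≤ 1 + lam i := fun i => by have := hl i; positivity
  have hE : ∀ M : Matrix (Fin n) (Fin p) ℝ,
      ∫ ω, ‖act M (d ω)‖ ^ 2 ∂P = (M * 𝓑.innovationCov * Mᵀ).trace :=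
    integral_norm_act_innovation_sq hBs hRs hx hε hind hd
  have hWB : 𝓑.B⁻¹ = (𝓑.weightRoot V fun _ => 1)ᵀ * 𝓑.weightRoot V fun _ => 1 := by
    rw [weightRoot_transpose_mul fun _ => zero_le_one, diagonal_one, Matrix.mul_one,
      prior_inv_eq hB ho]
  have hWP : 𝓑.posteriorCov⁻¹
      = (𝓑.weightRoot V fun i => 1 + lam i)ᵀ * 𝓑.weightRoot V fun i => 1 + lam i := by
    rw [weightRoot_transpose_mul hl1, posteriorCov_inv hB hR hV, precision_eq hB hV]
  have hint := fun M : Matrix (Fin n) (Fin p) ℝ =>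
    integrable_norm_act_innovation_sq hx hε hind hd M
  have hvar : ∀ ω, 𝓑.xVar U δ k (d ω) - 𝓑.posteriorMean (d ω)
      = act (𝓑.varGain U δ k - 𝓑.gain) (d ω) := fun ω => act_sub_act _ _ _
  have hdof : ∀ ω, 𝓑.xDof V k (d ω) - 𝓑.posteriorMean (d ω)
      = act ((𝓑.projected (𝓑.dofProjector V k)).gain - 𝓑.gain) (d ω) :=
    fun ω => act_sub_act _ _ _
  have hfr : ∀ ω, 𝓑.xFRDof V lam k (d ω) - 𝓑.posteriorMean (d ω)
      = act ((𝓑.dofCov V lam k - 𝓑.posteriorCov) * 𝓑.Hᵀ * 𝓑.R⁻¹) (d ω) := fun ω => by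
    rw [xFRDof, posteriorMean, ← posteriorCov_mul_eq_gain hB hR hV, act_sub_act,
      ← Matrix.sub_mul, ← Matrix.sub_mul]
  refine ⟨condExp_state_innovation hBs hRs hxm hεm hx hε hind hd (gain_mul_innovationCov hB hR),
    fun M => ⟨hint M, ?_, ?_⟩, rank_varGain_le hB hR hV hU k, rank_projected_gain_le hB ho k,
    dofCov_mem_lowRankUpdate hB hR hV k, ?_, ?_, ?_, ?_, ?_⟩
  · simp_rw [weightedNorm_sq_act hWB]; exact hint _
  · simp_rw [weightedNorm_sq_act hWP]; exact hint _
  · simp_rw [hvar]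
    exact isLeast_varGain hB hR hV hU hE k
  · simp_rw [hdof]
    refine isLeast_projected_gain hB hR hV (fun _ => zero_le_one) hWB hE
      (antitone_div_one_add hV.descending hl) (fun i => ?_) k
    rw [one_mul, div_eq_mul_inv]
  · simp_rw [hdof]
    refine isLeast_projected_gain hB hR hV hl1 hWP hE hV.descending (fun i => ?_) k
    have := hl i
    field_simp
  · simp_rw [hfr]
    refine isLeast_dofCov hB hR hV (fun _ => zero_le_one) hWB hE
      (antitone_pow_three_div_one_add hV.descending hl) (fun i => ?_) k
    have := hl i
    field_simp
    ring
  · simp_rw [hfr]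
    refine isLeast_dofCov hB hR hV hl1 hWP hE
      (fun i j hij => pow_le_pow_left₀ (hl j) (hV.descending hij) 3) (fun i => ?_) k
    have := hl i
    field_simp
    ring
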